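/- Let $\Gamma$ be a finite lower Eulerian poset: it has a unique minimal element $\hat 0_\Gamma$ and a function $\rho_\Gamma:\Gamma\to\mathbb Z$ (a rank function) with $\rho_\Gamma(z')=\rho_\Gamma(z)+1$ whenever $z'$ covers $z$, and $\sum_{z\le z''\le z'}(-1)^{\rho_\Gamma(z'')}=0$ for all $z<z'$. Let $q\neq\hat 0_\Gamma$ be an element of $\Gamma$ such that the join $z\vee q$ exists for every $z\in\Gamma$. Put $Y=\{z\in\Gamma: q\le z\}$, $X=\Gamma\smallsetminus Y$ and $\sigma:X\to Y$, $\sigma(x)=x\vee q$. (Every strong formal subdivision $\sigma:X\to Y$ between lower Eulerian posets arises in this way, with $\Gamma$ its non-Hausdorff mapping cylinder.) Let a finite group $W$ act on the poset $\Gamma$, fixing $q$, and suppose that the action is Eulerian: for every $w\in W$ the fixed poset $\Gamma^w$ is lower Eulerian. For $z\le z''\le z'$ let $W_{z,z'}=W_z\cap W_{z'}$ and $W_{z,z'',z'}=W_z\cap W_{z''}\cap W_{z'}$ be intersections of stabilizers, and let $R(\cdot)$ denote the complex representation ring, with character evaluation $\mathrm{ev}_w$ extended coefficientwise to polynomials in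 $t$. The equivariant incidence algebra $I^W(\Gamma)$ consists of the functions $p$ assigning to each $z\le z'$ an element $p(z,z')=p(z,z';t)\in R(W_{z,z'})[t]$ such that $p(z,z')$ is the pullback of $p(w z,w z')$ along the isomorphism $W_{z,z'}\to W_{wz,wz'}$, $w'\mapsto ww'w^{-1}$, for all $w\in W$. Its product is $$(p\cdot p')(z,z')=\sum_{z''}\mathrm{Ind}^{W_{z,z'}}_{W_{z,z'',z'}}\Big(\mathrm{Res}^{W_{z,z''}}_{W_{z,z'',z'}}p(z,z'')\cdot\mathrm{Res}^{W_{z'',z'}}_{W_{z,z'',z'}}p'(z'',z')\Big),$$ where $z''$ runs over representatives of the $W_{z,z'}$-orbits of $[z,z']$, and its identity is $\delta$, with $\delta(z,z)=1$ and $\delta(z,z')=0$ for $z<z'$. Let $r_\Gamma$ be a $W$-invariant weak rank function: it assigns to each $z\le z'$ a nonnegative integer, positive if $z<z'$, with $r_\Gamma(z,z')=r_\Gamma(z,z'')+r_\Gamma(z'',z')$ for $z\le z''\le z'$. Let $\mathscr I^W(\Gamma)$ be the set of $p\in I^W(\Gamma)$ with $\deg p(z,z')\le r_\Gamma(z,z')$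 for all $z\le z'$, with the involution $p^{\mathrm{rev}}(z,z';t)=t^{r_\Gamma(z,z')}p(z,z';t^{-1})$. Let $\mathscr I^W_{1/2}(\Gamma)$ be the set of $p\in\mathscr I^W(\Gamma)$ with $\deg p(z,z')<r_\Gamma(z,z')/2$ for all $z<z'$, and let $U^W(\Gamma)$ be the set of $p\in I^W(\Gamma)$ with $p(z,z)=1$ for all $z$. Let $\kappa_\Gamma\in\mathscr I^W(\Gamma)\cap U^W(\Gamma)$ be multiplicative, i.e. $\mathrm{ev}_w\kappa_\Gamma(z,z')=\mathrm{ev}_w\kappa_\Gamma(z,z'')\,\mathrm{ev}_w\kappa_\Gamma(z'',z')$ for all $w\in W$ and $z\le z''\le z'$ in $\Gamma^w$, and rank alternating, i.e. $\mathrm{ev}_w\kappa_\Gamma^{\mathrm{rev}}(z,z')=(-1)^{\rho_{\Gamma^w}(z')-\rho_{\Gamma^w}(z)}\,\mathrm{ev}_w\kappa_\Gamma(z,z')$ for all $w\in W$ and $z\le z'$ in $\Gamma^w$, where $\rho_{\Gamma^w}$ is a rank function of $\Gamma^w$. Then there is a unique $g_\Gamma\in\mathscr I^W_{1/2}(\Gamma)\cap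 U^W(\Gamma)$ with $g_\Gamma^{\mathrm{rev}}=g_\Gamma\cdot\kappa_\Gamma$; it has a unique inverse $g_\Gamma^{-1}$ in $I^W(\Gamma)$; there is a unique $h_\sigma\in\mathscr I^W(\Gamma)$ with $(t-1)\,h_\sigma=g_\Gamma\cdot\kappa_\Gamma|_{(X/Y)^\circ}$, where $\kappa_\Gamma|_{(X/Y)^\circ}$ agrees with $\kappa_\Gamma$ on the intervals $[x,\sigma(x)]$, $x\in X$, and is $0$ on all other intervals; and $\ell_\sigma:=h_\sigma\cdot g_\Gamma^{-1}$ lies in $\mathscr I^W(\Gamma)$. In particular the equivariant local $h$-polynomials $\ell_\sigma(x,y)\in R(W_{x,y})[t]$ are well defined. They are symmetric: for all $x\in X$ and $y\in Y$ with $\sigma(x)\le y$, $$\ell_\sigma(x,y;t)=t^{\,r_\Gamma(x,y)-1}\,\ell_\sigma(x,y;t^{-1}).$$ Equivalently, $(t-1)\,\ell_\sigma$ lies in $\mathscr I^W(\Gamma)$ and is antisymmetric: $(t-1)\,\ell_\sigma=-\big((t-1)\,\ell_\sigma\big)^{\mathrm{rev}}$. -/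

import Mathlib

open CategoryTheory MonoidalCategory Polynomial

namespace EquivariantKLS

universe u v w

noncomputable section

section RepresentationRing

variable {G : Type u} [Group G]

/-- Finite-dimensional complex representations of `G`. -/
abbrev FinRep (G : Type u) [Group G] := FDRep.{0} ℂ G

/-- An equivariant linear isomorphism is an isomorphism of representations. -/
def isoOfLinearEquiv {V V' : FinRep G} (e : V ≃ₗ[ℂ] V')
    (he : ∀ (g : G) (v : V), e (V.ρ g v) = V'.ρ g (e v)) : V ≅ V' :=
  Action.mkIso (LinearEquiv.toFGModuleCatIso e) fun g => by
    ext v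
    exact he g v

/-- The direct sum of two representations. -/
def dirSum (V V' : FinRep G) : FinRep G := FDRep.of (Representation.prod V.ρ V'.ρ)

theorem dirSum_rho (V V' : FinRep G) (g : G) :
    (dirSum V V').ρ g = (V.ρ g).prodMap (V'.ρ g) := rfl

/-- The elements `[V ⊕ V'] - ([V] + [V'])` of the free abelian group on isomorphism classes. -/
def addRelations (G : Type u) [Group G] : Set (FreeAbelianGroup (Skeleton (FinRep G))) :=
  {x | ∃ V V' : FinRep G, x = FreeAbelianGroup.of (toSkeleton (dirSum V V')) -
    (FreeAbelianGroup.of (toSkeleton V) + FreeAbelianGroup.of (toSkeleton V'))}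

/-- The complex representation ring `R(G)`: the free abelian group on the isomorphism classes of
finite-dimensional complex representations, modulo `[V ⊕ V'] = [V] + [V']`, with product
`[V] [V'] = [V ⊗ V']`. The product of the free abelian group is induced by the tensor product of
isomorphism classes. The ideal generated by the relations equals the additive subgroup generated
by them, see `span_addRelations_le`. -/
def RepRing (G : Type u) [Group G] : Type (max 1 u) :=
  FreeAbelianGroup (Skeleton (FinRep G)) ⧸ Ideal.span (addRelations G)

instance (G : Type u) [Group G] : CommRing (RepRing G) :=
  inferInstanceAs (CommRing (FreeAbelianGroup (Skeleton (FinRep G)) ⧸ Ideal.span (addRelations G)))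

/-- The quotient map. -/
def RepRing.mk : FreeAbelianGroup (Skeleton (FinRep G)) →+* RepRing G :=
  Ideal.Quotient.mk (Ideal.span (addRelations G))

theorem toSkeleton_eq_of_iso {V V' : FinRep G} (h : Nonempty (V ≅ V')) :
    toSkeleton V = toSkeleton V' := Quotient.sound h

theorem tensor_rho (V V' : FinRep G) (g : G) :
    (V ⊗ V').ρ g = TensorProduct.map (V.ρ g) (V'.ρ g) := rfl

/-- The tensor product distributes over direct sums. -/
def tensorDirSumIso (U V V' : FinRep G) :
    U ⊗ dirSum V V' ≅ dirSum (U ⊗ V) (U ⊗ V') :=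
  isoOfLinearEquiv (V := U ⊗ dirSum V V') (V' := dirSum (U ⊗ V) (U ⊗ V'))
    (show TensorProduct ℂ U (V × V') ≃ₗ[ℂ] TensorProduct ℂ U V × TensorProduct ℂ U V' from
      TensorProduct.prodRight ℂ ℂ U V V') fun g v => by
    have key : (TensorProduct.prodRight ℂ ℂ U V V').toLinearMap ∘ₗ
        TensorProduct.map (U.ρ g) ((V.ρ g).prodMap (V'.ρ g)) =
        ((TensorProduct.map (U.ρ g) (V.ρ g)).prodMap (TensorProduct.map (U.ρ g) (V'.ρ g))) ∘ₗ
        (TensorProduct.prodRight ℂ ℂ U V V').toLinearMap := by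
      ext <;> simp
    exact LinearMap.congr_fun key v

/-- The class `[V]`. -/
def repClass (V : FinRep G) : RepRing G :=
  RepRing.mk (FreeAbelianGroup.of (toSkeleton V))

theorem span_addRelations_le (x : FreeAbelianGroup (Skeleton (FinRep G)))
    (hx : x ∈ Ideal.span (addRelations G)) : x ∈ AddSubgroup.closure (addRelations G) := by
  refine Submodule.span_induction (fun x hx => AddSubgroup.subset_closure hx)
    (zero_mem _) (fun x y _ _ hx hy => add_mem hx hy) (fun a x _ hx => ?_) hx
  induction a using FreeAbelianGroup.induction_on with
  | zero => simp
  | of U =>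
    refine AddSubgroup.closure_induction (fun x hx => ?_) ?_ (fun x y _ _ hx hy => ?_)
      (fun x _ hx => ?_) hx
    · obtain ⟨V, V', rfl⟩ := hx
      refine AddSubgroup.subset_closure ⟨U.out ⊗ V, U.out ⊗ V', ?_⟩
      rw [smul_eq_mul, mul_sub, mul_add]
      simp only [FreeAbelianGroup.of_mul_of]
      have h (A : FinRep G) : U * toSkeleton A = toSkeleton (U.out ⊗ A) := by
        conv_lhs => rw [← Quotient.out_eq U]
        exact (Skeleton.toSkeleton_tensorObj _ _).symm
      rw [h, h, h, toSkeleton_eq_of_iso ⟨tensorDirSumIso _ _ _⟩]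
    · simp
    · rw [smul_add]; exact add_mem hx hy
    · rw [smul_neg]; exact neg_mem hx
  | neg U h => rw [neg_smul]; exact neg_mem h
  | add a b ha hb => rw [add_smul]; exact add_mem ha hb

/-- An isomorphism-invariant function on representations that is additive on direct sums extends
to an additive map on `R(G)`. -/
def RepRing.liftAdd {A : Type w} [AddCommGroup A] (f : FinRep G → A)
    (hiso : ∀ V V' : FinRep G, Nonempty (V ≅ V') → f V = f V')
    (hadd : ∀ V V' : FinRep G, f (dirSum V V') = f V + f V') : RepRing G →+ A :=
  QuotientAddGroup.lift (Submodule.toAddSubgroup (Ideal.span (addRelations G)))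
      (FreeAbelianGroup.lift (Quotient.lift f hiso)) fun x hx => by
    have h : AddSubgroup.closure (addRelations G) ≤
        (FreeAbelianGroup.lift (Quotient.lift f hiso)).ker := by
      refine (AddSubgroup.closure_le _).mpr ?_
      rintro _ ⟨V, V', rfl⟩
      have e (V : FinRep G) :
          FreeAbelianGroup.lift (Quotient.lift f hiso) (FreeAbelianGroup.of (toSkeleton V)) = f V :=
        FreeAbelianGroup.lift_apply_of _ _
      refine AddMonoidHom.mem_ker.mpr ?_
      refine (map_sub _ _ _).trans (sub_eq_zero.mpr ((e _).trans ((hadd V V').trans ?_)))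
      exact ((map_add _ _ _).trans (congrArg₂ _ (e V) (e V'))).symm
    exact h (span_addRelations_le x hx)

theorem RepRing.liftAdd_repClass {A : Type w} [AddCommGroup A] (f : FinRep G → A) (hiso hadd)
    (V : FinRep G) : RepRing.liftAdd f hiso hadd (repClass V) = f V :=
  FreeAbelianGroup.lift_apply_of _ _

theorem repClass_eq_of_iso {V V' : FinRep G} (h : Nonempty (V ≅ V')) : 
    repClass V = repClass V' := by
  unfold repClass; rw [toSkeleton_eq_of_iso h]

theorem repClass_dirSum (V V' : FinRep G) : 
    repClass (dirSum V V') = repClass V + repClass V' := by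
  unfold repClass
  rw [← map_add]
  exact Ideal.Quotient.eq.mpr (Ideal.subset_span (s := addRelations G) ⟨V, V', rfl⟩)

theorem repClass_tensor (V V' : FinRep G) : 
    repClass (V ⊗ V') = repClass V * repClass V' := by
  unfold repClass
  rw [Skeleton.toSkeleton_tensorObj, FreeAbelianGroup.of_mul, map_mul]

theorem repClass_unit : repClass (𝟙_ (FinRep G)) = 1 := rfl

theorem RepRing.induction {p : RepRing G → Prop} (hz : p 0) (hV : ∀ V, p (repClass V))
    (hn : ∀ x, p x → p (-x)) (ha : ∀ x y, p x → p y → p (x + y)) (x : RepRing G) : p x := by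
  obtain ⟨x, rfl⟩ : ∃ y, RepRing.mk y = x := Ideal.Quotient.mk_surjective x
  induction x using FreeAbelianGroup.induction_on with
  | zero => simpa using hz
  | of U =>
    rw [← Quotient.out_eq U]
    exact hV _
  | neg U h => rw [map_neg]; exact hn _ h
  | add a b ha' hb => rw [map_add]; exact ha _ _ ha' hb

/-- If the function is moreover multiplicative on tensor products, the extension is a ring
homomorphism. -/
def RepRing.liftRing {A : Type w} [CommRing A] (f : FinRep G → A)
    (hiso : ∀ V V' : FinRep G, Nonempty (V ≅ V') → f V = f V')
    (hadd : ∀ V V' : FinRep G, f (dirSum V V') = f V + f V') 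
    (hone : f (𝟙_ _) = 1) 
    (hmul : ∀ V V' : FinRep G, f (V ⊗ V') = f V * f V') : RepRing G →+* A where
  __ := RepRing.liftAdd f hiso hadd
  map_one' := by
    change RepRing.liftAdd f hiso hadd 1 = 1
    rw [← repClass_unit, RepRing.liftAdd_repClass, hone]
  map_mul' x y := by
    change RepRing.liftAdd f hiso hadd (x * y) = 
      RepRing.liftAdd f hiso hadd x * RepRing.liftAdd f hiso hadd y
    induction x using RepRing.induction with
    | hz => simp
    | hn x h => rw [neg_mul, map_neg, h, map_neg, neg_mul]
    | ha x x' h h' => rw [add_mul, map_add, h, h', map_add, add_mul]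
    | hV V =>
      induction y using RepRing.induction with
      | hz => simp
      | hn x h => rw [mul_neg, map_neg, h, map_neg, mul_neg]
      | ha x x' h h' => rw [mul_add, map_add, h, h', map_add, mul_add]
      | hV V' => simp only [← repClass_tensor, RepRing.liftAdd_repClass, hmul]

/-- Evaluation of characters at `g`: the ring homomorphism with `ev_g [V] = χ_V(g)`. -/
def RepRing.ev (g : G) : RepRing G →+* ℂ :=
  RepRing.liftRing (fun V => V.character g) 
    (fun _ _ ⟨i⟩ => congrFun (FDRep.char_iso i) g) 
    (fun V V' => LinearMap.trace_prodMap' _ _)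
    (by
      change LinearMap.trace ℂ ℂ (LinearMap.id) = 1
      simp)
    (fun V V' => by rw [FDRep.char_tensor]; rfl)

/-- The pullback of a representation along a group homomorphism. -/
def resObj {H : Type v} [Group H] (φ : G →* H) (V : FinRep H) : FinRep G :=
  FDRep.of (V.ρ.comp φ)

/-- Pullback `Λ_φ : R(H) → R(G)` along `φ : G → H`. For the inclusion of a subgroup this is
restriction. -/
def RepRing.res {H : Type v} [Group H] (φ : G →* H) : RepRing H →+* RepRing G :=
  RepRing.liftRing (fun V => repClass (resObj φ V))
    (fun _ _ ⟨i⟩ => repClass_eq_of_iso ⟨(Action.res (FGModuleCat ℂ) φ).mapIso i⟩)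
    (fun V V' => repClass_dirSum (resObj φ V) (resObj φ V'))
    repClass_unit
    (fun V V' => repClass_tensor (resObj φ V) (resObj φ V'))

/-- A finite-dimensional representation on a space in any universe, transported to `ℂⁿ` along a
basis. -/
def finModel {V : Type v} [AddCommGroup V] [Module ℂ V] [Module.Finite ℂ V]
    (ρ : Representation ℂ G V) : FinRep G :=
  FDRep.of (V := Fin (Module.finrank ℂ V) → ℂ)
    (((Module.finBasis ℂ V).equivFun.conjRingEquiv : _ →* _).comp ρ)

/-- Isomorphic representations have isomorphic coordinate models. -/
def finModelIso {V : Type v} [AddCommGroup V] [Module ℂ V] [Module.Finite ℂ V]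
    {V' : Type w} [AddCommGroup V'] [Module ℂ V'] [Module.Finite ℂ V']
    {ρ : Representation ℂ G V} {ρ' : Representation ℂ G V'} (e : ρ.Equiv ρ') :
    finModel ρ ≅ finModel ρ' :=
  isoOfLinearEquiv (V := finModel ρ) (V' := finModel ρ')
    ((Module.finBasis ℂ V).equivFun.symm ≪≫ₗ e.toLinearEquiv ≪≫ₗ (Module.finBasis ℂ V').equivFun)
    fun g v => by
      have h := e.toIntertwiningMap.isIntertwining _ _ g ((Module.finBasis ℂ V).equivFun.symm v)
      change (Module.finBasis ℂ V').equivFun (e ((Module.finBasis ℂ V).equivFun.symm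
        ((Module.finBasis ℂ V).equivFun (ρ g ((Module.finBasis ℂ V).equivFun.symm v))))) =
        (Module.finBasis ℂ V').equivFun (ρ' g ((Module.finBasis ℂ V').equivFun.symm
          ((Module.finBasis ℂ V').equivFun (e ((Module.finBasis ℂ V).equivFun.symm v)))))
      rw [LinearEquiv.symm_apply_apply, LinearEquiv.symm_apply_apply]
      exact congrArg _ h

/-- Coordinate models are compatible with direct sums. -/
def finModelProdIso {V : Type v} [AddCommGroup V] [Module ℂ V] [Module.Finite ℂ V]
    {V' : Type w} [AddCommGroup V'] [Module ℂ V'] [Module.Finite ℂ V']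
    (ρ : Representation ℂ G V) (ρ' : Representation ℂ G V') :
    finModel (ρ.prod ρ') ≅ dirSum (finModel ρ) (finModel ρ') :=
  isoOfLinearEquiv (V := finModel (ρ.prod ρ')) (V' := dirSum (finModel ρ) (finModel ρ'))
    ((Module.finBasis ℂ (V × V')).equivFun.symm ≪≫ₗ
      LinearEquiv.prodCongr (Module.finBasis ℂ V).equivFun (Module.finBasis ℂ V').equivFun)
    fun g v => by
      change LinearEquiv.prodCongr (Module.finBasis ℂ V).equivFun (Module.finBasis ℂ V').equivFun
        ((Module.finBasis ℂ (V × V')).equivFun.symm ((Module.finBasis ℂ (V × V')).equivFun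
          ((ρ.prod ρ') g ((Module.finBasis ℂ (V × V')).equivFun.symm v)))) = _
      rw [LinearEquiv.symm_apply_apply]
      change _ = ((Module.finBasis ℂ V).equivFun (ρ g ((Module.finBasis ℂ V).equivFun.symm
          ((Module.finBasis ℂ V).equivFun ((Module.finBasis ℂ (V × V')).equivFun.symm v).1))),
        (Module.finBasis ℂ V').equivFun (ρ' g ((Module.finBasis ℂ V').equivFun.symm
          ((Module.finBasis ℂ V').equivFun ((Module.finBasis ℂ (V × V')).equivFun.symm v).2))))
      rw [LinearEquiv.symm_apply_apply, LinearEquiv.symm_apply_apply]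
      rfl

section Induction

variable {H : Type v} [Group H] (φ : G →* H)

/-- Induction is functorial. -/
def indMap {V : Type w} [AddCommGroup V] [Module ℂ V] {V' : Type w} [AddCommGroup V'] [Module ℂ V']
    {ρ : Representation ℂ G V} {ρ' : Representation ℂ G V'} (f : ρ.IntertwiningMap ρ') :
    (ρ.ind φ).IntertwiningMap (ρ'.ind φ) :=
  ⟨Representation.Coinvariants.map _ _ ⟨f.toLinearMap.lTensor _, by
    simp [LinearMap.lTensor_comp_map, f.2, LinearMap.map_comp_lTensor]⟩,
    fun g ↦ by ext; simp⟩

instance [Finite H] {V : Type w} [AddCommGroup V] [Module ℂ V] [Module.Finite ℂ V]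
    (ρ : Representation ℂ G V) : Module.Finite ℂ (Representation.IndV φ ρ) := by
  have : Module.Finite ℂ (MonoidAlgebra ℂ H) :=
    Module.Finite.equiv (MonoidAlgebra.coeffLinearEquiv ℂ).symm
  exact Module.Finite.of_surjective _ (Representation.Coinvariants.mk_surjective _)

/-- Induction preserves isomorphisms. -/
def indEquiv {V : Type w} [AddCommGroup V] [Module ℂ V] {V' : Type w} [AddCommGroup V'] [Module ℂ V']
    {ρ : Representation ℂ G V} {ρ' : Representation ℂ G V'} (e : ρ.Equiv ρ') :
    (ρ.ind φ).Equiv (ρ'.ind φ) :=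
  Representation.Equiv.mk
    (LinearEquiv.ofLinearMap (indMap φ e.toIntertwiningMap).toLinearMap
      (indMap φ e.symm.toIntertwiningMap).toLinearMap
      (by ext; simp [indMap]) (by ext; simp [indMap]))
    (indMap φ e.toIntertwiningMap).isIntertwining'

theorem inl_apply {V : Type w} [AddCommGroup V] [Module ℂ V] {V' : Type w} [AddCommGroup V']
    [Module ℂ V'] (ρ : Representation ℂ G V) (ρ' : Representation ℂ G V') (x : V) :
    Representation.IntertwiningMap.inl ℂ ρ ρ' x = (x, 0) := rfl

theorem inr_apply {V : Type w} [AddCommGroup V] [Module ℂ V] {V' : Type w} [AddCommGroup V']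
    [Module ℂ V'] (ρ : Representation ℂ G V) (ρ' : Representation ℂ G V') (x : V') :
    Representation.IntertwiningMap.inr ℂ ρ ρ' x = (0, x) := rfl

/-- Induction preserves direct sums. -/
def indProdEquiv {V : Type w} [AddCommGroup V] [Module ℂ V] {V' : Type w} [AddCommGroup V']
    [Module ℂ V'] (ρ : Representation ℂ G V) (ρ' : Representation ℂ G V') :
    ((ρ.prod ρ').ind φ).Equiv ((ρ.ind φ).prod (ρ'.ind φ)) :=
  Representation.Equiv.mk
    (LinearEquiv.ofLinearMap
      ((indMap φ (Representation.IntertwiningMap.fst ℂ ρ ρ')).toLinearMap.prod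
        (indMap φ (Representation.IntertwiningMap.snd ℂ ρ ρ')).toLinearMap)
      ((indMap φ (Representation.IntertwiningMap.inl ℂ ρ ρ')).toLinearMap.coprod
        (indMap φ (Representation.IntertwiningMap.inr ℂ ρ ρ')).toLinearMap)
      (by ext <;> simp [indMap, inl_apply, inr_apply])
      (by ext <;> simp [indMap, inl_apply, inr_apply]))
    (fun g => by ext <;> simp [indMap])

/-- Induction `R(G) → R(H)` along `φ : G → H` (used for inclusions of subgroups): the additive map
with `[V] ↦ [Ind V]`. -/
def RepRing.ind [Finite H] : RepRing G →+ RepRing H :=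
  RepRing.liftAdd (fun V => repClass (finModel (Representation.ind φ V.ρ)))
    (fun V V' ⟨i⟩ => repClass_eq_of_iso ⟨finModelIso (indEquiv φ
      (Representation.Equiv.mk (FDRep.isoToLinearEquiv i) fun g => by
        ext v
        have h := FDRep.Iso.conj_ρ i g
        rw [h]
        simp [LinearEquiv.conj_apply]))⟩)
    (fun V V' => by
      rw [← repClass_dirSum]
      refine repClass_eq_of_iso ⟨?_⟩
      exact finModelIso (indProdEquiv φ (V := V) (V' := V') V.ρ V'.ρ) ≪≫ finModelProdIso _ _)

/-- Induction applied to each coefficient of a polynomial. -/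
def indPoly [Finite H] (p : (RepRing G)[X]) : (RepRing H)[X] :=
  p.sum fun i a => monomial i (RepRing.ind φ a)

end Induction

end RepresentationRing

section Posets

/-- `ρ` is a rank function: it increases by one along every cover. -/
def IsRankFunction {B : Type v} [PartialOrder B] (ρ : B → ℤ) : Prop :=
  ∀ z z' : B, z ⋖ z' → ρ z' = ρ z + 1

/-- A (finite) poset is lower Eulerian if it has a unique minimal element and a rank function `ρ`
such that `∑_{z ≤ z'' ≤ z'} (-1)^ρ(z'') = 0` whenever `z < z'`. -/
def IsLowerEulerian (B : Type v) [PartialOrder B] : Prop :=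
  (∃! b : B, IsMin b) ∧ ∃ ρ : B → ℤ, IsRankFunction ρ ∧
    ∀ z z' : B, z < z' → ∑ᶠ z'' ∈ Set.Icc z z', ((ρ z'').negOnePow : ℤ) = 0

/-- `q` is join-admissible if the join `z ∨ q` exists for every `z`. -/
def IsJoinAdmissible {B : Type v} [PartialOrder B] (q : B) : Prop :=
  ∀ z : B, ∃ s, IsLUB {z, q} s

/-- `σ(z) = z ∨ q`. -/
def sigma {B : Type v} [PartialOrder B] {q : B} (hq : IsJoinAdmissible q) (z : B) : B :=
  (hq z).choose

theorem sigma_isLUB {B : Type v} [PartialOrder B] {q : B} (hq : IsJoinAdmissible q) (z : B) :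
    IsLUB {z, q} (sigma hq z) := (hq z).choose_spec

theorem le_sigma {B : Type v} [PartialOrder B] {q : B} (hq : IsJoinAdmissible q) (z : B) :
    z ≤ sigma hq z := (sigma_isLUB hq z).1 (by simp)

/-- `Y = {z : q ≤ z}`. -/
def upperPart {B : Type v} [PartialOrder B] (q : B) : Set B := {z | q ≤ z}

/-- `X = Γ \ Y`. -/
def lowerPart {B : Type v} [PartialOrder B] (q : B) : Set B := (upperPart q)ᶜ

/-- Weak rank functions (only the values `r z z'` with `z ≤ z'` matter). -/
structure IsWeakRankFunction {B : Type v} [PartialOrder B] (r : B → B → ℕ) : Prop where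
  pos : ∀ z z', z < z' → 0 < r z z'
  add : ∀ z z'' z', z ≤ z'' → z'' ≤ z' → r z z' = r z z'' + r z'' z'

end Posets

section Stabilizers

variable {W : Type u} [Group W] {B : Type v} [MulAction W B]

/-- `W_{z,z'} = W_z ∩ W_{z'}`. -/
def stab₂ (W : Type u) [Group W] {B : Type v} [MulAction W B] (z z' : B) : Subgroup W :=
  MulAction.stabilizer W z ⊓ MulAction.stabilizer W z'

/-- `W_{z,z'',z'} = W_z ∩ W_{z''} ∩ W_{z'}`. -/
def stab₃ (W : Type u) [Group W] {B : Type v} [MulAction W B] (z z'' z' : B) : Subgroup W :=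
  MulAction.stabilizer W z ⊓ MulAction.stabilizer W z'' ⊓ MulAction.stabilizer W z'

theorem stab₃_le (z z'' z' : B) : stab₃ W z z'' z' ≤ stab₂ W z z' :=
  fun _ h => ⟨h.1.1, h.2⟩

theorem stab₃_le_left (z z'' z' : B) : stab₃ W z z'' z' ≤ stab₂ W z z'' :=
  fun _ h => ⟨h.1.1, h.1.2⟩

theorem stab₃_le_right (z z'' z' : B) : stab₃ W z z'' z' ≤ stab₂ W z'' z' :=
  fun _ h => ⟨h.1.2, h.2⟩

/-- Conjugation `w' ↦ w w' w⁻¹` as a homomorphism `W_{z,z'} → W_{w • z, w • z'}`. -/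
def conjStab (w : W) (z z' : B) : stab₂ W z z' →* stab₂ W (w • z) (w • z') :=
  ((MulAut.conj w).toMonoidHom.comp (stab₂ W z z').subtype).codRestrict _ fun a => by
    have h1 : (a : W) • z = z := a.2.1
    have h2 : (a : W) • z' = z' := a.2.2
    constructor <;> simp [MulAction.mem_stabilizer_iff, mul_smul, h1, h2]

end Stabilizers

section EquivariantIncidenceAlgebra

variable {W : Type u} [Group W] {B : Type v} [PartialOrder B] [MulAction W B]

/-- The action is Eulerian: every fixed poset `B^w` is lower Eulerian. -/
def IsEulerianAction (W : Type u) [Group W] (B : Type v) [PartialOrder B] [MulAction W B] : Prop :=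
  ∀ w : W, IsLowerEulerian (MulAction.fixedBy B w)

/-- Functions that assign to every interval `[z, z']` an element of `R(W_{z,z'})[t]`. -/
abbrev IntervalFn (W : Type u) [Group W] (B : Type v) [PartialOrder B] [MulAction W B] :=
  ∀ z z' : B, z ≤ z' → (RepRing (stab₂ W z z'))[X]

namespace IntervalFn

/-- Membership in the equivariant incidence algebra `I^W(B)`: compatibility with conjugation. -/
def IsEquivariant (p : IntervalFn W B) : Prop :=
  ∀ (w : W) (z z' : B) (h : z ≤ z') (h' : w • z ≤ w • z'),
    p z z' h = (p (w • z) (w • z') h').map (RepRing.res (conjStab w z z'))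

open Classical in
/-- The product of the equivariant incidence algebra: `(p p')(z, z')` is the sum, over
representatives `z''` of the `W_{z,z'}`-orbits of `[z, z']`, of
`Ind (Res p(z, z'') * Res p'(z'', z'))`, where `Res` restricts to `W_{z,z'',z'}` and `Ind` induces
from `W_{z,z'',z'}` to `W_{z,z'}`. -/
def mul [Finite W] (p p' : IntervalFn W B) : IntervalFn W B := fun z z' _ =>
  ∑ᶠ o : MulAction.orbitRel.Quotient (stab₂ W z z') B,
    if h : z ≤ Quotient.out o ∧ Quotient.out o ≤ z' then
      indPoly (Subgroup.inclusion (stab₃_le z (Quotient.out o) z'))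
        ((p z (Quotient.out o) h.1).map
            (RepRing.res (Subgroup.inclusion (stab₃_le_left z (Quotient.out o) z'))) *
          (p' (Quotient.out o) z' h.2).map
            (RepRing.res (Subgroup.inclusion (stab₃_le_right z (Quotient.out o) z'))))
    else 0

open Classical in
/-- The identity element `δ`. -/
def delta : IntervalFn W B := fun z z' _ => if z = z' then 1 else 0

open Classical in
/-- The restriction `p|_S` to a set `S` of intervals. -/
def restrict (p : IntervalFn W B) (S : B → B → Prop) : IntervalFn W B :=
  fun z z' h => if S z z' then p z z' h else 0

/-- Multiplication by `t - 1`. -/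
def tSubOneMul (p : IntervalFn W B) : IntervalFn W B := fun z z' h => (X - 1) * p z z' h

/-- Membership in `𝓘^W(B)`: equivariant, and the degree of `p(z, z')` is at most `r(z, z')`. -/
def MemI (r : B → B → ℕ) (p : IntervalFn W B) : Prop :=
  p.IsEquivariant ∧ ∀ z z' h, (p z z' h).degree ≤ r z z'

/-- Membership in `𝓘^W_{1/2}(B)`: moreover the degree of `p(z, z')` is less than `r(z, z') / 2` for
`z < z'`. (As `r(z, z') > 0` for `z < z'`, using `natDegree` makes no difference for the zero
polynomial.) -/
def MemIHalf (r : B → B → ℕ) (p : IntervalFn W B) : Prop :=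
  p.MemI r ∧ ∀ z z' (h : z < z'), 2 * (p z z' h.le).natDegree < r z z'

/-- Membership in `U^W(B)`. -/
def MemU (p : IntervalFn W B) : Prop := ∀ z, p z z le_rfl = 1

/-- `p^rev(z, z'; t) = t^r(z,z') p(z, z'; t⁻¹)`, for `p` in `𝓘^W(B)`. -/
def rev (r : B → B → ℕ) (p : IntervalFn W B) : IntervalFn W B :=
  fun z z' h => (p z z' h).reflect (r z z')

/-- `ev_w(p)(z, z')`, for `z ≤ z'` in `B^w`. -/
def evAt (p : IntervalFn W B) (w : W) (z z' : MulAction.fixedBy B w) (h : z ≤ z') : ℂ[X] :=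
  (p z z' h).map (RepRing.ev ⟨w, z.2, z'.2⟩)

/-- `p` is multiplicative: `ev_w(p(z, z')) = ev_w(p(z, z'')) ev_w(p(z'', z'))` for all `w` and
`z ≤ z'' ≤ z'` in `B^w`. -/
def IsMultiplicative (p : IntervalFn W B) : Prop :=
  ∀ (w : W) (z z'' z' : MulAction.fixedBy B w) (h : z ≤ z'') (h' : z'' ≤ z'),
    p.evAt w z z' (h.trans h') = p.evAt w z z'' h * p.evAt w z'' z' h'

/-- `p` is rank alternating: `ev_w(p^rev)(z, z') = (-1)^(ρ(z') - ρ(z)) ev_w(p)(z, z')` for all `w`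
and `z ≤ z'` in `B^w`, where `ρ` is a rank function of `B^w`. (Rank functions of a lower Eulerian
poset agree up to a shift.) -/
def IsRankAlternating (r : B → B → ℕ) (p : IntervalFn W B) : Prop :=
  ∀ (w : W) (ρ : MulAction.fixedBy B w → ℤ), IsRankFunction ρ →
    ∀ (z z' : MulAction.fixedBy B w) (h : z ≤ z'),
      (p.rev r).evAt w z z' h = ((ρ z' - ρ z).negOnePow : ℤ) • p.evAt w z z' h

/-- `p'` is the inverse of `p` in `I^W(B)`. -/
def IsInverse [Finite W] (p p' : IntervalFn W B) : Prop :=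
  p'.IsEquivariant ∧ p.mul p' = delta ∧ p'.mul p = delta

/-- `g` is the left equivariant Kazhdan-Lusztig-Stanley function of `κ`:
`g ∈ 𝓘^W_{1/2}(B) ∩ U^W(B)` and `g^rev = g κ`. -/
def IsLeftKLS [Finite W] (r : B → B → ℕ) (κ g : IntervalFn W B) : Prop :=
  g.MemIHalf r ∧ g.MemU ∧ g.rev r = g.mul κ

/-- `h` is the family of equivariant `h`-polynomials: `h ∈ 𝓘^W(B)` and
`(t - 1) h = g κ|_{(X/Y)°}`, where `(X/Y)°` is the set of intervals `[x, σ(x)]` with `x ∈ X`. -/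
def IsHPolynomial [Finite W] (r : B → B → ℕ) {q : B} (hq : IsJoinAdmissible q)
    (κ g h : IntervalFn W B) : Prop :=
  h.MemI r ∧ h.tSubOneMul = g.mul (κ.restrict fun z z' => z ∈ lowerPart q ∧ z' = sigma hq z)

end IntervalFn

end EquivariantIncidenceAlgebra

end

end EquivariantKLS

/-! Everything is reduced to characters. For a finite group, characters separate elements of the
representation ring (`RepRing.ext_ev`), and Frobenius' formula for induced characters turns the
product of the equivariant incidence algebra into plain matrix multiplication over each fixed poset
`Γ^w` (`char_mul`, `toMatrix_mul`): the orbit representatives, restrictions and inductions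
disappear.

Put `a = κ|_(X/Y)°`. Then `(t - 1) ℓ = g a g⁻¹`. Reversal is multiplicative and `g^rev = g κ`, so
antisymmetry of `g a g⁻¹` follows from the single identity `κ a^rev = -a κ` (`rev_conj_eq_neg`). On
`Γ^w`, multiplicativity and rank alternation make every term of a product of `κ` with a reversed `κ`
a sign times `κ(z, z')`. The identity thus becomes a statement about the signs `(-1)^ρ(u)` of the
elements `u` of `X` above `z` with `u ∨ q = z'` (`mul_rev_restrict`). It is a Weisner-type theorem:
if `z` is not above `q` and `z ∨ q ≤ y`, the signs over the fibre `u ≥ z`, `u ∨ q = y` cancel,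
because the fibres over `v ≤ y` partition `[z, y]`, whose total sign is zero
(`sum_sign_join_eq_zero`). The only element of `Y` in the fibre is `y` itself, which supplies the
term `-a κ`. Joins with `q` restrict to `Γ^w` because `q` is fixed.

The same sign bookkeeping gives `κ κ^rev = δ`, from which `g` is built by recursion on intervals,
taking at each step the low half of an antisymmetric polynomial (`existsUnique_isLeftKLS`).
Divisibility by `t - 1` holds because the characters of `κ` vanish at `t = 1` on nontrivial
intervals (`eval_one_toMatrix`). Finally, cancelling the antisymmetric factor `t - 1` converts
antisymmetry in degree `r` into symmetry in degree `r - 1`. -/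

open CategoryTheory MonoidalCategory Polynomial

namespace EquivariantKLS

universe u v w

noncomputable section

/-! ### Characters: Frobenius' formula, and injectivity on the representation ring. -/

section Characters

variable {G : Type u} [Group G]

/-- The averaging operator `A` factors through the coinvariants as `s ∘ mk` with `mk ∘ s = id`, so
cyclicity of the trace gives `tr f = tr (A F)`. -/
theorem trace_coinvariants [Fintype G] {V : Type w} [AddCommGroup V] [Module ℂ V]
    [Module.Finite ℂ V] (ρ : Representation ℂ G V) (F : V →ₗ[ℂ] V)
    (f : ρ.Coinvariants →ₗ[ℂ] ρ.Coinvariants)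
    (h : f ∘ₗ Representation.Coinvariants.mk ρ = Representation.Coinvariants.mk ρ ∘ₗ F) :
    LinearMap.trace ℂ _ f =
      (Fintype.card G : ℂ)⁻¹ * ∑ g : G, LinearMap.trace ℂ V (ρ g ∘ₗ F) := by
  set A : V →ₗ[ℂ] V := (Fintype.card G : ℂ)⁻¹ • ∑ g : G, ρ g with hA
  have hA1 : ∀ x, A ∘ₗ ρ x = A := fun x => by
    rw [hA, LinearMap.smul_comp, ← Module.End.mul_eq_comp, Finset.sum_mul]
    congr 1
    rw [← Equiv.sum_comp (Equiv.mulRight x) (fun g => ρ g)]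
    refine Finset.sum_congr rfl fun g _ => ?_
    rw [Equiv.coe_mulRight, map_mul]
  have hA2 : Representation.Coinvariants.mk ρ ∘ₗ A = Representation.Coinvariants.mk ρ := by
    ext x
    have h0 : (Fintype.card G : ℂ) ≠ 0 := Nat.cast_ne_zero.mpr Fintype.card_ne_zero
    simp only [hA, LinearMap.comp_apply, LinearMap.smul_apply, LinearMap.sum_apply, map_smul,
      map_sum, Representation.Coinvariants.mk_self_apply, Finset.sum_const, Finset.card_univ]
    rw [← Nat.cast_smul_eq_nsmul ℂ, smul_smul, inv_mul_cancel₀ h0, one_smul]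
  set s : ρ.Coinvariants →ₗ[ℂ] V := Representation.Coinvariants.lift ρ A hA1
  have hs1 : s ∘ₗ Representation.Coinvariants.mk ρ = A :=
    Representation.Coinvariants.lift_comp_mk _ _ _
  have hs2 : Representation.Coinvariants.mk ρ ∘ₗ s = LinearMap.id := by
    apply Representation.Coinvariants.hom_ext
    rw [LinearMap.comp_assoc, hs1, hA2, LinearMap.id_comp]
  calc LinearMap.trace ℂ _ f
      = LinearMap.trace ℂ _ ((f ∘ₗ Representation.Coinvariants.mk ρ) ∘ₗ s) := by
        rw [LinearMap.comp_assoc, hs2, LinearMap.comp_id]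
    _ = LinearMap.trace ℂ _ (s ∘ₗ (f ∘ₗ Representation.Coinvariants.mk ρ)) :=
        LinearMap.trace_comp_comm' _ _
    _ = LinearMap.trace ℂ _ (A ∘ₗ F) := by rw [h, ← LinearMap.comp_assoc, hs1]
    _ = _ := by
        rw [hA, LinearMap.smul_comp, ← Module.End.mul_eq_comp, Finset.sum_mul, map_smul, map_sum,
          smul_eq_mul]
        rfl

open Classical in
theorem trace_mapDomain {H : Type v} [Finite H] (f : H → H) :
    LinearMap.trace ℂ _ (MonoidAlgebra.mapDomainLinearMap ℂ ℂ f) =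
      (Nat.card {x : H // f x = x} : ℂ) := by
  have := Fintype.ofFinite H
  let b : Module.Basis H ℂ (MonoidAlgebra ℂ H) := ⟨MonoidAlgebra.coeffLinearEquiv ℂ⟩
  have hb : ∀ x, b x = MonoidAlgebra.single x 1 := fun x => rfl
  have hb' : ∀ y x, b.repr y x = y.coeff x := fun y x => rfl
  rw [LinearMap.trace_eq_matrix_trace ℂ b, Matrix.trace]
  simp only [Matrix.diag_apply, LinearMap.toMatrix_apply, hb, hb']
  simp [Finsupp.single_apply, Nat.card_eq_fintype_card, Fintype.card_subtype]

-- Frobenius' formula in averaged form, free of coset representatives and valid for any homomorphism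
-- `φ`. The induced space consists of the coinvariants of `ℂ[H] ⊗ V`, on which `h` acts by right
-- translation by `h⁻¹`; composed with `g`, the factor `ℂ[H]` contributes the number of `x` with `φ
-- g * x * h⁻¹ = x`.
open Classical in
theorem trace_ind {H : Type v} [Group H] [Fintype H] [Fintype G] (φ : G →* H) {V : Type w}
    [AddCommGroup V] [Module ℂ V] [Module.Finite ℂ V] (ρ : Representation ℂ G V) (h : H) :
    LinearMap.trace ℂ _ (ρ.ind φ h) =
      (Fintype.card G : ℂ)⁻¹ * ∑ g : G, ∑ x : H,
        if φ g = x * h * x⁻¹ then LinearMap.trace ℂ V (ρ g) else 0 := by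
  have : Module.Finite ℂ (MonoidAlgebra ℂ H) :=
    Module.Finite.equiv (MonoidAlgebra.coeffLinearEquiv ℂ).symm
  rw [trace_coinvariants _
    ((MonoidAlgebra.mapDomainLinearMap ℂ ℂ fun x => x * h⁻¹).rTensor V) (ρ.ind φ h) rfl]
  congr 1
  refine Finset.sum_congr rfl fun g _ => ?_
  have e : (Representation.tprod ((Representation.leftRegular ℂ H).comp φ) ρ) g ∘ₗ
      (MonoidAlgebra.mapDomainLinearMap ℂ ℂ fun x => x * h⁻¹).rTensor V =
      TensorProduct.map (MonoidAlgebra.mapDomainLinearMap ℂ ℂ fun x => φ g * (x * h⁻¹)) (ρ g) := by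
    ext x v
    simp
  rw [e, LinearMap.trace_tensorProduct', trace_mapDomain, Nat.card_eq_fintype_card,
    Fintype.card_subtype, ← Finset.sum_filter, Finset.sum_const, nsmul_eq_mul]
  congr 3
  ext x
  simp only [Finset.mem_filter, Finset.mem_univ, true_and]
  constructor
  · intro hx
    have : φ g = x * (x * h⁻¹)⁻¹ := eq_mul_inv_of_mul_eq hx
    rw [this]; group
  · intro hx
    rw [hx]; group

theorem ev_repClass (g : G) (V : FinRep G) :
    RepRing.ev g (repClass V) = LinearMap.trace ℂ V (V.ρ g) :=
  RepRing.liftAdd_repClass (fun V => V.character g) _ (fun _ _ => LinearMap.trace_prodMap' _ _) V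

theorem trace_finModel {V : Type v} [AddCommGroup V] [Module ℂ V] [Module.Finite ℂ V]
    (ρ : Representation ℂ G V) (g : G) :
    LinearMap.trace ℂ (finModel ρ) ((finModel ρ).ρ g) = LinearMap.trace ℂ V (ρ g) :=
  LinearMap.trace_conj' (ρ g) (Module.finBasis ℂ V).equivFun

theorem res_repClass {H : Type v} [Group H] (φ : G →* H) (V : FinRep H) :
    RepRing.res φ (repClass V) = repClass (resObj φ V) :=
  RepRing.liftAdd_repClass (fun V => repClass (resObj φ V))
    (fun _ _ ⟨i⟩ => repClass_eq_of_iso ⟨(Action.res (FGModuleCat ℂ) φ).mapIso i⟩)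
    (fun V V' => repClass_dirSum (resObj φ V) (resObj φ V')) V

theorem ind_repClass {H : Type v} [Group H] [Finite H] (φ : G →* H) (V : FinRep G) :
    RepRing.ind φ (repClass V) = repClass (finModel (Representation.ind φ V.ρ)) :=
  RepRing.liftAdd_repClass _ _ _ _

theorem ev_res {H : Type v} [Group H] (φ : G →* H) (g : G) (a : RepRing H) :
    RepRing.ev g (RepRing.res φ a) = RepRing.ev (φ g) a := by
  induction a using RepRing.induction with
  | hz => simp
  | hV V =>
    rw [res_repClass, ev_repClass, ev_repClass]
    rfl
  | hn x h => rw [map_neg, map_neg, h, map_neg]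
  | ha x y hx hy => rw [map_add, map_add, hx, hy, map_add]

open Classical in
theorem ev_ind {H : Type v} [Group H] [Fintype H] [Fintype G] (φ : G →* H) (h : H)
    (a : RepRing G) :
    RepRing.ev h (RepRing.ind φ a) = (Fintype.card G : ℂ)⁻¹ * ∑ g : G, ∑ x : H,
      if φ g = x * h * x⁻¹ then RepRing.ev g a else 0 := by
  induction a using RepRing.induction with
  | hz => simp
  | hV V =>
    rw [ind_repClass, ev_repClass, trace_finModel, trace_ind]
    simp only [ev_repClass]
  | hn x h =>
    rw [map_neg, map_neg, h, ← mul_neg, ← Finset.sum_neg_distrib]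
    refine congrArg _ (Finset.sum_congr rfl fun g _ => ?_)
    rw [← Finset.sum_neg_distrib]
    refine Finset.sum_congr rfl fun x _ => ?_
    split_ifs <;> simp
  | ha x y hx hy =>
    rw [map_add, map_add, hx, hy, ← mul_add, ← Finset.sum_add_distrib]
    refine congrArg _ (Finset.sum_congr rfl fun g _ => ?_)
    rw [← Finset.sum_add_distrib]
    refine Finset.sum_congr rfl fun x _ => ?_
    split_ifs <;> simp

open Classical in
theorem map_ev_indPoly {H : Type v} [Group H] [Fintype H] [Fintype G] (φ : G →* H) (h : H)
    (p : (RepRing G)[X]) :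
    (indPoly φ p).map (RepRing.ev h) = C (Fintype.card G : ℂ)⁻¹ * ∑ g : G, ∑ x : H,
      if φ g = x * h * x⁻¹ then p.map (RepRing.ev g) else 0 := by
  have hc : ∀ n, (indPoly φ p).coeff n = RepRing.ind φ (p.coeff n) := fun n => by
    rw [indPoly, Polynomial.sum, finsetSum_coeff]
    simp only [coeff_monomial]
    rw [Finset.sum_ite_eq' p.support n]
    split_ifs with hn
    · rfl
    · rw [notMem_support_iff.mp hn, map_zero]
  ext n
  rw [coeff_map, hc, ev_ind, coeff_C_mul, finsetSum_coeff]
  refine congrArg _ (Finset.sum_congr rfl fun g _ => ?_)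
  rw [finsetSum_coeff]
  refine Finset.sum_congr rfl fun x _ => ?_
  split_ifs <;> simp

/-- The finite-dimensional representation on an invariant subspace. -/
def subRep {V : FinRep G} (S : Subrepresentation V.ρ) : FinRep G := FDRep.of S.toRepresentation

theorem isCompl_toSubmodule {V : Type w} [AddCommGroup V] [Module ℂ V] {ρ : Representation ℂ G V}
    {S T : Subrepresentation ρ} (h : IsCompl S T) : IsCompl S.toSubmodule T.toSubmodule := by
  constructor
  · rw [disjoint_iff, ← Subrepresentation.toSubmodule_inf, h.inf_eq_bot]; rfl
  · rw [codisjoint_iff, ← Subrepresentation.toSubmodule_sup, h.sup_eq_top]; rfl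

theorem repClass_eq_add_of_isCompl {V : FinRep G} {S T : Subrepresentation V.ρ}
    (h : IsCompl S T) : repClass V = repClass (subRep S) + repClass (subRep T) := by
  rw [← repClass_dirSum]
  refine (repClass_eq_of_iso ⟨isoOfLinearEquiv (V := dirSum (subRep S) (subRep T)) (V' := V)
    (Submodule.prodEquivOfIsCompl _ _ (isCompl_toSubmodule h)) fun g v => ?_⟩).symm
  change ((V.ρ g v.1.1 + V.ρ g v.2.1 : V)) = V.ρ g (v.1.1 + v.2.1)
  rw [map_add]

/-- The dimension of `Hom_G(V, V')` depends only on the two characters, so it equals that of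
`End_G(V)`, which contains the identity. -/
theorem exists_ne_zero_of_trace_eq [Finite G] {V V' : FinRep G}
    (h : ∀ g, LinearMap.trace ℂ V (V.ρ g) = LinearMap.trace ℂ V' (V'.ρ g)) (hV : Nontrivial V) :
    ∃ f : Representation.IntertwiningMap V.ρ V'.ρ, f.toLinearMap ≠ 0 := by
  have := Fintype.ofFinite G
  have : Invertible (Nat.card G : ℂ) :=
    invertibleOfNonzero (Nat.cast_ne_zero.mpr Nat.card_pos.ne')
  have h1 := Representation.card_inv_mul_sum_char_mul_char_eq_finrank V.ρ V'.ρ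
  have h2 := Representation.card_inv_mul_sum_char_mul_char_eq_finrank V.ρ V.ρ
  have h3 : (Module.finrank ℂ (Representation.IntertwiningMap V.ρ V'.ρ) : ℂ) =
      Module.finrank ℂ (Representation.IntertwiningMap V.ρ V.ρ) := by
    rw [← h1, ← h2]
    simp only [Representation.character, h]
  have h4 := Nat.cast_injective h3
  have hfin : Module.Finite ℂ (Representation.IntertwiningMap V.ρ V.ρ) :=
    Module.Finite.equiv (Representation.invariantsEquivIntertwiningMap V.ρ V.ρ)
  have : Nontrivial (Representation.IntertwiningMap V.ρ V.ρ) := by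
    obtain ⟨x, hx⟩ := exists_ne (0 : V)
    exact ⟨Representation.IntertwiningMap.id V.ρ, 0, fun e => hx (congrArg (fun f => f x) e)⟩
  have h5 : 0 < Module.finrank ℂ (Representation.IntertwiningMap V.ρ V'.ρ) := by
    rw [h4]; exact Module.finrank_pos
  have := Module.nontrivial_of_finrank_pos h5
  obtain ⟨f, hf⟩ := exists_ne (0 : Representation.IntertwiningMap V.ρ V'.ρ)
  exact ⟨f, fun e => hf (by ext x; exact LinearMap.congr_fun e x)⟩

/-- Representations with the same character have the same class. -/
theorem repClass_eq_of_trace_eq [Finite G] (n : ℕ) : ∀ V V' : FinRep G, Module.finrank ℂ V = n →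
    (∀ g, LinearMap.trace ℂ V (V.ρ g) = LinearMap.trace ℂ V' (V'.ρ g)) →
    repClass V = repClass V' := by
  induction n using Nat.strong_induction_on with
  | _ n ih =>
  intro V V' hn h
  have hdim : Module.finrank ℂ V = Module.finrank ℂ V' := by
    have := h 1
    rw [map_one (V.ρ), map_one (V'.ρ), LinearMap.trace_one, LinearMap.trace_one] at this
    exact Nat.cast_injective this
  rcases subsingleton_or_nontrivial V with hV | hV
  · have hV' : Subsingleton V' := by
      rw [← Module.finrank_zero_iff (R := ℂ), ← hdim, Module.finrank_zero_iff]; exact hV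
    exact repClass_eq_of_iso ⟨isoOfLinearEquiv (V := V) (V' := V')
      (LinearEquiv.ofFinrankEq _ _ hdim) fun g v => Subsingleton.elim _ _⟩
  obtain ⟨f, hf⟩ := exists_ne_zero_of_trace_eq h hV
  have hfg : ∀ g x, f.toLinearMap (V.ρ g x) = V'.ρ g (f.toLinearMap x) :=
    fun g x => f.isIntertwining _ _ g x
  let K : Subrepresentation V.ρ := ⟨LinearMap.ker f.toLinearMap, fun g v hv => by
    rw [LinearMap.mem_ker] at hv ⊢; rw [hfg, hv, map_zero]⟩
  let R : Subrepresentation V'.ρ := ⟨LinearMap.range f.toLinearMap, by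
    rintro g _ ⟨v, rfl⟩; exact ⟨V.ρ g v, hfg g v⟩⟩
  -- This enables Maschke's theorem. With `V = K ⊕ D` and `V' = R ⊕ D'`, the map `f` identifies `D`
  -- with `R`; then `K` and `D'` have equal characters, and `K` is smaller than `V` because `f ≠ 0`.
  have : NeZero (Nat.card G : ℂ) := ⟨Nat.cast_ne_zero.mpr Nat.card_pos.ne'⟩
  obtain ⟨D, hD⟩ := ComplementedLattice.exists_isCompl K
  obtain ⟨D', hD'⟩ := ComplementedLattice.exists_isCompl R
  have e1 := repClass_eq_add_of_isCompl hD
  have e2 := repClass_eq_add_of_isCompl hD'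
  have hDK := isCompl_toSubmodule hD
  have iso : repClass (subRep D) = repClass (subRep R) := by
    have hinj : Function.Injective (f.toLinearMap.domRestrict D.toSubmodule) := by
      rw [← LinearMap.ker_eq_bot, LinearMap.ker_eq_bot']
      intro x hx
      have hxK : (x : V) ∈ K.toSubmodule := LinearMap.mem_ker.mpr hx
      exact Subtype.ext (Submodule.disjoint_def.mp hDK.disjoint _ hxK x.2)
    have hrange : LinearMap.range (f.toLinearMap.domRestrict D.toSubmodule) =
        LinearMap.range f.toLinearMap := by
      apply le_antisymm
      · rintro _ ⟨x, rfl⟩; exact ⟨x, rfl⟩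
      · rintro _ ⟨x, rfl⟩
        obtain ⟨k, hk, d, hd, rfl⟩ := Submodule.mem_sup.mp
          (hDK.sup_eq_top.symm ▸ Submodule.mem_top : x ∈ K.toSubmodule ⊔ D.toSubmodule)
        exact ⟨⟨d, hd⟩, by rw [map_add, LinearMap.mem_ker.mp hk, zero_add]; rfl⟩
    refine repClass_eq_of_iso ⟨isoOfLinearEquiv (V := subRep D) (V' := subRep R)
      ((LinearEquiv.ofInjective _ hinj).trans (LinearEquiv.ofEq _ _ hrange)) fun g v => ?_⟩
    exact Subtype.ext (hfg g v.1)
  have hK : repClass (subRep K) = repClass (subRep D') := by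
    refine ih _ ?_ _ _ rfl fun g => ?_
    · rw [← hn]
      refine Submodule.finrank_lt (s := LinearMap.ker f.toLinearMap) fun htop => hf ?_
      exact LinearMap.ker_eq_top.mp htop
    · have h1 := congrArg (RepRing.ev g) e1
      have h2 := congrArg (RepRing.ev g) e2
      have h3 := congrArg (RepRing.ev g) iso
      rw [map_add] at h1 h2
      rw [ev_repClass g V, h g, ← ev_repClass, h2, h3, add_comm] at h1
      rw [← ev_repClass, ← ev_repClass]
      exact (add_right_cancel h1).symm
  rw [e1, e2, iso, hK, add_comm]

theorem RepRing.exists_sub (x : RepRing G) : ∃ V V' : FinRep G, x = repClass V - repClass V' := by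
  induction x using RepRing.induction with
  | hz => exact ⟨𝟙_ _, 𝟙_ _, (sub_self _).symm⟩
  | hV V => exact ⟨dirSum V V, V, by rw [repClass_dirSum]; abel⟩
  | hn x h =>
    obtain ⟨V, V', rfl⟩ := h
    exact ⟨V', V, by abel⟩
  | ha x y hx hy =>
    obtain ⟨V, V', rfl⟩ := hx
    obtain ⟨U, U', rfl⟩ := hy
    exact ⟨dirSum V U, dirSum V' U', by rw [repClass_dirSum, repClass_dirSum]; abel⟩

/-- Elements of the representation ring are determined by their characters. -/
theorem RepRing.ext_ev [Finite G] {x y : RepRing G} (h : ∀ g, RepRing.ev g x = RepRing.ev g y) :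
    x = y := by
  rw [← sub_eq_zero]
  obtain ⟨V, V', e⟩ := RepRing.exists_sub (x - y)
  rw [e, sub_eq_zero]
  refine repClass_eq_of_trace_eq _ V V' rfl fun g => ?_
  rw [← ev_repClass, ← ev_repClass, ← sub_eq_zero, ← map_sub, ← e, map_sub, h, sub_self]

theorem poly_ext_ev [Finite G] {p p' : (RepRing G)[X]}
    (h : ∀ g, p.map (RepRing.ev g) = p'.map (RepRing.ev g)) : p = p' := by
  ext n
  refine RepRing.ext_ev fun g => ?_
  rw [← coeff_map, h, coeff_map]

theorem degree_le_of_ev [Finite G] {p : (RepRing G)[X]} {n : ℕ}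
    (h : ∀ g, (p.map (RepRing.ev g)).degree ≤ n) : p.degree ≤ n := by
  rw [degree_le_iff_coeff_zero]
  intro m hm
  refine RepRing.ext_ev fun g => ?_
  rw [← coeff_map, (degree_le_iff_coeff_zero _ _).mp (h g) m hm, map_zero]

end Characters

/-! ### The character transform: from the equivariant incidence algebra to matrices over fixed
posets. -/

section Transform

open Classical in
theorem sum_smul_eq_card_stabilizer {H : Type u} [Group H] [Fintype H] {B : Type v} [Fintype B]
    [MulAction H B] {A : Type w} [AddCommMonoid A] (F : B → A) (b : B) :
    ∑ x : H, F (x • b) =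
      Fintype.card (MulAction.stabilizer H b) • ∑ u : MulAction.orbit H b, F u := by
  have key : ∀ u : MulAction.orbit H b,
      ∑ x : H, (if x • b = u then F u else 0) =
        Fintype.card (MulAction.stabilizer H b) • F u := by
    rintro ⟨_, x0, rfl⟩
    rw [← Finset.sum_filter, Finset.sum_const]
    congr 1
    rw [Fintype.card_subtype]
    refine Finset.card_bij' (fun x _ => x0⁻¹ * x) (fun x _ => x0 * x) ?_ ?_ ?_ ?_
    · intro x hx
      rw [Finset.mem_filter] at hx ⊢
      exact ⟨Finset.mem_univ _, by
        rw [MulAction.mem_stabilizer_iff, mul_smul, hx.2]; exact inv_smul_smul x0 b⟩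
    · intro x hx
      rw [Finset.mem_filter] at hx ⊢
      refine ⟨Finset.mem_univ _, ?_⟩
      rw [mul_smul, MulAction.mem_stabilizer_iff.mp hx.2]
    · intro x _; simp
    · intro x _; simp
  rw [Finset.smul_sum, ← Finset.sum_congr rfl fun u _ => key u, Finset.sum_comm]
  refine Finset.sum_congr rfl fun x _ => ?_
  rw [Finset.sum_eq_single (⟨x • b, x, rfl⟩ : MulAction.orbit H b)]
  · rw [if_pos rfl]
  · intro u _ hu
    rw [if_neg]
    exact fun e => hu (Subtype.ext e.symm)
  · intro h; exact absurd (Finset.mem_univ _) h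

open Classical in
theorem sum_orbits {H : Type u} [Group H] [Fintype H] {B : Type v} [Fintype B]
    [MulAction H B] {A : Type w} [AddCommMonoid A] (F : B → A) :
    ∑ o : MulAction.orbitRel.Quotient H B, ∑ u : MulAction.orbit H (Quotient.out o), F u =
      ∑ u, F u := by
  rw [← Equiv.sum_comp (MulAction.selfEquivSigmaOrbits H B).symm F, Fintype.sum_sigma]
  rfl

variable {W : Type u} [Group W] {B : Type v} [PartialOrder B] [MulAction W B]

instance fixedByFintype [Finite B] (w : W) : Fintype (MulAction.fixedBy B w) := Fintype.ofFinite _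

namespace IntervalFn

open Classical in
/-- The character value of `p(z, z')` at `w`, extended by zero to all `w`, `z`, `z'`. -/
def char (p : IntervalFn W B) (w : W) (z z' : B) : ℂ[X] :=
  if h : z ≤ z' ∧ w • z = z ∧ w • z' = z' then
    (p z z' h.1).map (RepRing.ev ⟨w, h.2.1, h.2.2⟩) else 0

theorem char_of (p : IntervalFn W B) {w : W} {z z' : B} (h : z ≤ z') (hz : w • z = z)
    (hz' : w • z' = z') : p.char w z z' = (p z z' h).map (RepRing.ev ⟨w, hz, hz'⟩) :=
  dif_pos ⟨h, hz, hz'⟩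

theorem char_eq_zero (p : IntervalFn W B) {w : W} {z z' : B}
    (h : ¬ (z ≤ z' ∧ w • z = z ∧ w • z' = z')) : p.char w z z' = 0 := dif_neg h

theorem ext_char [Finite W] {p p' : IntervalFn W B} (h : ∀ w z z', p.char w z z' = p'.char w z z') :
    p = p' := by
  funext z z' hz
  refine poly_ext_ev fun g => ?_
  have := h g z z'
  rwa [char_of p hz g.2.1 g.2.2, char_of p' hz g.2.1 g.2.2] at this

theorem ext_char_apply [Finite W] {p p' : IntervalFn W B} {z z' : B} (hz : z ≤ z')
    (h : ∀ w, p.char w z z' = p'.char w z z') : p z z' hz = p' z z' hz := by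
  refine poly_ext_ev fun g => ?_
  have := h g
  rwa [char_of p hz g.2.1 g.2.2, char_of p' hz g.2.1 g.2.2] at this

theorem char_congr {p p' : IntervalFn W B} {z z' : B} (h : ∀ hz, p z z' hz = p' z z' hz) (w : W) :
    p.char w z z' = p'.char w z z' := by
  by_cases hh : z ≤ z' ∧ w • z = z ∧ w • z' = z'
  · rw [char_of p hh.1 hh.2.1 hh.2.2, char_of p' hh.1 hh.2.1 hh.2.2, h]
  · rw [char_eq_zero _ hh, char_eq_zero _ hh]

/-- Equivariance seen on characters; together with the converse `isEquivariant_of_char` it lets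
closure properties be checked on complex polynomials. -/
theorem IsEquivariant.char_conj (hmono : ∀ (w : W) (z z' : B), z ≤ z' → w • z ≤ w • z')
    {p : IntervalFn W B} (hp : p.IsEquivariant) (x w : W) (z z' : B) :
    p.char (x * w * x⁻¹) (x • z) (x • z') = p.char w z z' := by
  have hfix : ∀ z : B, (x * w * x⁻¹) • x • z = x • z ↔ w • z = z := fun z => by
    rw [mul_smul, mul_smul, inv_smul_smul]
    exact (MulAction.injective x).eq_iff
  have hle : x • z ≤ x • z' ↔ z ≤ z' :=
    ⟨fun h => by simpa using hmono x⁻¹ _ _ h, hmono x z z'⟩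
  by_cases h : z ≤ z' ∧ w • z = z ∧ w • z' = z'
  · rw [char_of p h.1 h.2.1 h.2.2,
      char_of p (hle.mpr h.1) ((hfix z).mpr h.2.1) ((hfix z').mpr h.2.2),
      hp x z z' h.1 (hle.mpr h.1), Polynomial.map_map]
    congr 1
    ext a
    rw [RingHom.comp_apply, ev_res]
    rfl
  · rw [char_eq_zero p h, char_eq_zero]
    rwa [hle, hfix, hfix]

theorem isEquivariant_of_char [Finite W] {p : IntervalFn W B}
    (h : ∀ (x w : W) (z z' : B), z ≤ z' → w • z = z → w • z' = z' →
      p.char (x * w * x⁻¹) (x • z) (x • z') = p.char w z z') : p.IsEquivariant := by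
  intro x z z' hz hxz
  refine poly_ext_ev fun g => ?_
  have e := h x g z z' hz g.2.1 g.2.2
  have hfix : ∀ z : B, (g : W) • z = z → (x * g * x⁻¹) • x • z = x • z := fun z hz => by
    rw [mul_smul, mul_smul, inv_smul_smul, hz]
  rw [char_of p hz g.2.1 g.2.2, char_of p hxz (hfix _ g.2.1) (hfix _ g.2.2)] at e
  rw [Polynomial.map_map]
  refine Eq.trans e.symm ?_
  congr 1
  ext a
  rw [RingHom.comp_apply, ev_res]
  rfl

/-- The matrix of character values at `w` over the poset of fixed points of `w`. -/
def toMatrix (p : IntervalFn W B) (w : W) :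
    Matrix (MulAction.fixedBy B w) (MulAction.fixedBy B w) ℂ[X] :=
  Matrix.of fun z z' => p.char w z z'

theorem toMatrix_apply (p : IntervalFn W B) (w : W) (z z' : MulAction.fixedBy B w) :
    p.toMatrix w z z' = p.char w z z' := rfl

theorem toMatrix_apply_of_le (p : IntervalFn W B) (w : W) (z z' : MulAction.fixedBy B w)
    (h : z ≤ z') : p.toMatrix w z z' = p.evAt w z z' h :=
  char_of p h z.2 z'.2

theorem toMatrix_apply_of_not_le (p : IntervalFn W B) (w : W) (z z' : MulAction.fixedBy B w)
    (h : ¬ z ≤ z') : p.toMatrix w z z' = 0 :=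
  char_eq_zero p fun hh => h hh.1

theorem toMatrix_delta (w : W) [DecidableEq (MulAction.fixedBy B w)] : (delta : IntervalFn W B).toMatrix w = 1 := by
  ext1 z z'
  by_cases h : z = z'
  · subst h
    rw [Matrix.one_apply_eq, toMatrix_apply_of_le _ _ _ _ le_rfl, evAt, delta, if_pos rfl,
      Polynomial.map_one]
  · rw [Matrix.one_apply_ne h]
    by_cases hz : z ≤ z'
    · rw [toMatrix_apply_of_le _ _ _ _ hz, evAt, delta, if_neg fun e => h (Subtype.ext e),
        Polynomial.map_zero]
    · exact toMatrix_apply_of_not_le _ _ _ _ hz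

theorem ext_toMatrix [Finite W] {p p' : IntervalFn W B} (h : ∀ w, p.toMatrix w = p'.toMatrix w) : p = p' := by
  refine ext_char fun w z z' => ?_
  by_cases hh : z ≤ z' ∧ w • z = z ∧ w • z' = z'
  · exact congrFun₂ (h w) ⟨z, hh.2.1⟩ ⟨z', hh.2.2⟩
  · rw [char_eq_zero _ hh, char_eq_zero _ hh]

variable [Finite W] [Finite B]

-- Frobenius' formula sums over `x` in `W_{z,z'}`. Since `x` fixes `z` and `z'`, conjugating the
-- character values by `x` only moves the middle point `y` to `x⁻¹ • y`. Every point of the orbit is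
-- then met `|W_{z,y,z'}|` times, which cancels the normalising factor.
omit [Finite B] in
open Classical in
theorem map_ev_ind_eq_sum_orbit [Fintype W] [Fintype B]
    (hmono : ∀ (w : W) (z z' : B), z ≤ z' → w • z ≤ w • z')
    {p p' : IntervalFn W B} (hp : p.IsEquivariant) (hp' : p'.IsEquivariant) {z y z' : B}
    (hy : z ≤ y) (hy' : y ≤ z') (v : stab₂ W z z') :
    (indPoly (Subgroup.inclusion (stab₃_le z y z'))
        ((p z y hy).map (RepRing.res (Subgroup.inclusion (stab₃_le_left z y z'))) *
          (p' y z' hy').map (RepRing.res (Subgroup.inclusion (stab₃_le_right z y z'))))).map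
      (RepRing.ev v) =
    ∑ u : MulAction.orbit (stab₂ W z z') y, p.char v z u * p'.char v u z' := by
  set F : B → ℂ[X] := fun u => p.char v z u * p'.char v u z' with hF
  have hfixz : ∀ x : stab₂ W z z', (x : W) • z = z := fun x => x.2.1
  have hfixz' : ∀ x : stab₂ W z z', (x : W) • z' = z' := fun x => x.2.2
  -- `W_{z,y,z'}` is the stabilizer of `y` inside `W_{z,z'}`.
  have hcard : Fintype.card (stab₃ W z y z') =
      Fintype.card (MulAction.stabilizer (stab₂ W z z') y) :=
    Fintype.card_congr ⟨fun s => ⟨⟨s, s.2.1.1, s.2.2⟩, s.2.1.2⟩,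
      fun s => ⟨s, ⟨s.1.2.1, s.2⟩, s.1.2.2⟩, fun s => rfl, fun s => rfl⟩
  have hcard0 : (Fintype.card (stab₃ W z y z') : ℂ) ≠ 0 :=
    Nat.cast_ne_zero.mpr Fintype.card_ne_zero
  have e : ∑ x : stab₂ W z z', F (x • y) =
      Fintype.card (stab₃ W z y z') • ∑ u : MulAction.orbit (stab₂ W z z') y, F u := by
    rw [hcard, sum_smul_eq_card_stabilizer]
  rw [map_ev_indPoly]
  suffices hs : ∀ x : stab₂ W z z', F (x⁻¹ • y) = ∑ g : stab₃ W z y z',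
      if Subgroup.inclusion (stab₃_le z y z') g = x * v * x⁻¹ then
        (((p z y hy).map (RepRing.res (Subgroup.inclusion (stab₃_le_left z y z'))) *
        (p' y z' hy').map (RepRing.res (Subgroup.inclusion
          (stab₃_le_right z y z')))).map (RepRing.ev g)) else 0 by
    rw [Finset.sum_comm]
    refine (congrArg (fun a => C (Fintype.card (stab₃ W z y z') : ℂ)⁻¹ * a)
      (a₂ := ∑ x : stab₂ W z z', F (x⁻¹ • y)) (Finset.sum_congr rfl fun x _ => ?_)).trans ?_
    · rw [hs x]; congr!
    rw [show ∑ x : stab₂ W z z', F (x⁻¹ • y) = _ from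
      Equiv.sum_comp (Equiv.inv (stab₂ W z z')) (fun x => F (x • y)), e, nsmul_eq_mul,
      ← mul_assoc, ← C_eq_natCast, ← C_mul, inv_mul_cancel₀ hcard0, C_1, one_mul]
  intro x
  set v' : stab₂ W z z' := x * v * x⁻¹ with hv'
  have hv'' : (v' : W) = x * v * (x : W)⁻¹ := rfl
  have hFx : F (x⁻¹ • y) = p.char v' z y * p'.char v' y z' := by
    have h1 := hp.char_conj hmono x v z (x⁻¹ • y)
    have h2 := hp'.char_conj hmono x v (x⁻¹ • y) z'
    have hy' : (x : W) • x⁻¹ • y = y := smul_inv_smul x y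
    rw [hy', hfixz x, ← hv''] at h1
    rw [hy', hfixz' x, ← hv''] at h2
    rw [h1, h2]
  rw [hFx]
  -- At most one `g` contributes, namely the conjugate `v'` itself, and only if it lies in
  -- `W_{z,y,z'}`.
  by_cases hfix : (v' : W) • y = y
  · rw [Finset.sum_eq_single (⟨v', ⟨hfixz v', hfix⟩, hfixz' v'⟩ : stab₃ W z y z')]
    · refine Eq.trans ?_ (if_pos rfl).symm
      rw [Polynomial.map_mul, Polynomial.map_map, Polynomial.map_map,
        char_of p hy (hfixz v') hfix, char_of p' hy' hfix (hfixz' v')]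
      congr 2
      · ext a
        rw [RingHom.comp_apply, ev_res]
        rfl
      · ext a
        rw [RingHom.comp_apply, ev_res]
        rfl
    · intro g _ hg
      rw [if_neg]
      exact fun e => hg (Subtype.ext (show (g : W) = v' from congrArg Subtype.val e))
    · intro hn; exact absurd (Finset.mem_univ _) hn
  · rw [char_eq_zero p fun hh => hfix hh.2.2, zero_mul]
    refine (Finset.sum_eq_zero fun g _ => ?_).symm
    rw [if_neg]
    intro e
    refine hfix ?_
    rw [← show (g : W) = v' from congrArg Subtype.val e]
    exact g.2.1.2

-- The group `W_{z,z'}` preserves `[z, z']`, so an orbit whose representative lies outside the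
-- interval avoids it entirely. This matches the zero branch of `mul`.
omit [Finite W] [Finite B] in
open Classical in
theorem sum_orbit_eq_zero [Fintype B]
    (hmono : ∀ (w : W) (z z' : B), z ≤ z' → w • z ≤ w • z')
    (p p' : IntervalFn W B) {z y z' : B} (hy : ¬ (z ≤ y ∧ y ≤ z')) (w : W) :
    ∑ u : MulAction.orbit (stab₂ W z z') y, p.char w z u * p'.char w u z' = 0 := by
  refine Finset.sum_eq_zero fun u _ => ?_
  obtain ⟨_, ⟨x, hx⟩, rfl⟩ := u
  change p.char w z (x • y) * p'.char w (x • y) z' = 0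
  have hinv : ∀ a b : B, x • a ≤ x • b → a ≤ b := fun a b hab => by
    simpa using hmono x⁻¹ _ _ hab
  by_cases h1 : z ≤ y
  · rw [char_eq_zero p', mul_zero]
    rintro ⟨h2, -⟩
    rw [← show x • z' = z' from hx.2] at h2
    exact hy ⟨h1, hinv _ _ h2⟩
  · rw [char_eq_zero p, zero_mul]
    rintro ⟨h2, -⟩
    rw [← show x • z = z from hx.1] at h2
    exact h1 (hinv _ _ h2)

-- The bridge of the whole proof: on characters the equivariant product is ordinary convolution. The
-- sum may run over all of `B` because `char` vanishes off comparable fixed points.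
omit [Finite B] in
theorem char_mul [Fintype B] (hmono : ∀ (w : W) (z z' : B), z ≤ z' → w • z ≤ w • z')
    {p p' : IntervalFn W B} (hp : p.IsEquivariant) (hp' : p'.IsEquivariant) (w : W) (z z' : B) :
    (p.mul p').char w z z' = ∑ u, p.char w z u * p'.char w u z' := by
  classical
  by_cases h : z ≤ z' ∧ w • z = z ∧ w • z' = z'
  swap
  · rw [char_eq_zero _ h]
    refine (Finset.sum_eq_zero fun u _ => ?_).symm
    by_cases h1 : z ≤ u ∧ w • z = z ∧ w • u = u
    · rw [char_eq_zero p', mul_zero]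
      exact fun h2 => h ⟨h1.1.trans h2.1, h1.2.1, h2.2.2⟩
    · rw [char_eq_zero p h1, zero_mul]
  have : Fintype W := Fintype.ofFinite W
  rw [char_of _ h.1 h.2.1 h.2.2, mul, finsum_eq_sum_of_fintype, Polynomial.map_sum,
    ← sum_orbits (H := stab₂ W z z') (fun u : B => p.char w z u * p'.char w u z')]
  refine Finset.sum_congr rfl fun o _ => ?_
  split_ifs with ho
  · exact map_ev_ind_eq_sum_orbit hmono hp hp' ho.1 ho.2 _
  · rw [Polynomial.map_zero, sum_orbit_eq_zero hmono p p' ho]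

omit [PartialOrder B] [Finite W] in
/-- Sums over all elements that are supported on the fixed points. -/
theorem sum_fixedBy [Fintype B] {A : Type w} [AddCommMonoid A] (w : W) (F : B → A)
    (hF : ∀ u, w • u ≠ u → F u = 0) : ∑ u : MulAction.fixedBy B w, F u = ∑ u, F u := by
  classical
  rw [← Finset.sum_filter_of_ne (p := fun u => u ∈ MulAction.fixedBy B w)
    (fun u _ hu => not_imp_comm.mp (hF u) hu)]
  exact (Finset.sum_subtype (p := fun u => u ∈ MulAction.fixedBy B w) _ (fun u => by simp) F).symm

theorem toMatrix_mul (hmono : ∀ (w : W) (z z' : B), z ≤ z' → w • z ≤ w • z')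
    {p p' : IntervalFn W B} (hp : p.IsEquivariant) (hp' : p'.IsEquivariant) (w : W) :
    (p.mul p').toMatrix w = p.toMatrix w * p'.toMatrix w := by
  classical
  have := Fintype.ofFinite B
  ext1 z z'
  rw [toMatrix_apply, char_mul hmono hp hp', Matrix.mul_apply]
  exact (sum_fixedBy w (fun u => p.char w z u * p'.char w u z') fun u hu => by
    rw [char_eq_zero p fun hh => hu hh.2.2, zero_mul]).symm

end IntervalFn

end Transform

/-! ### Reversal and truncation of polynomials. -/

section Polynomial

theorem reflect_sum {R : Type u} [Semiring R] {ι : Type v} (n : ℕ) (s : Finset ι) (f : ι → R[X]) :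
    reflect n (∑ i ∈ s, f i) = ∑ i ∈ s, reflect n (f i) := by
  classical
  induction s using Finset.induction_on with
  | empty => simp
  | insert a s ha ih => rw [Finset.sum_insert ha, Finset.sum_insert ha, reflect_add, ih]

theorem degree_reflect_le {R : Type u} [Semiring R] {n : ℕ} {p : R[X]} (hp : p.degree ≤ n) :
    (reflect n p).degree ≤ n := by
  rw [degree_le_iff_coeff_zero] at hp ⊢
  intro m hm
  rw [coeff_reflect, revAt_eq_self_of_lt (by exact_mod_cast hm), hp m hm]

/-- The part of a polynomial in degrees `< n / 2`. -/
def halfTrunc {R : Type u} [Semiring R] (n : ℕ) (p : R[X]) : R[X] :=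
  ∑ i ∈ Finset.range ((n + 1) / 2), monomial i (p.coeff i)

theorem coeff_halfTrunc {R : Type u} [Semiring R] (n : ℕ) (p : R[X]) (i : ℕ) :
    (halfTrunc n p).coeff i = if 2 * i < n then p.coeff i else 0 := by
  rw [halfTrunc, finsetSum_coeff]
  simp only [coeff_monomial]
  rw [Finset.sum_ite_eq' (Finset.range ((n + 1) / 2)) i]
  have : i ∈ Finset.range ((n + 1) / 2) ↔ 2 * i < n := by rw [Finset.mem_range]; omega
  simp only [this]

theorem map_halfTrunc {R : Type u} [Semiring R] {S : Type v} [Semiring S] (f : R →+* S) (n : ℕ)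
    (p : R[X]) : (halfTrunc n p).map f = halfTrunc n (p.map f) := by
  ext i
  rw [coeff_map, coeff_halfTrunc, coeff_halfTrunc, coeff_map]
  split_ifs <;> simp

theorem natDegree_halfTrunc_lt {R : Type u} [Semiring R] {n : ℕ} (hn : 0 < n) (p : R[X]) :
    2 * (halfTrunc n p).natDegree < n := by
  by_cases h : halfTrunc n p = 0
  · rw [h, natDegree_zero]; omega
  · by_contra hlt
    have := coeff_halfTrunc n p (halfTrunc n p).natDegree
    rw [if_neg hlt] at this
    exact h (leadingCoeff_eq_zero.mp this)

/-- The reversal of `p` lives strictly above degree `n / 2`, so the low half sees only `-p`. This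
recovers a Kazhdan-Lusztig-Stanley function from `g^rev - g` and gives its uniqueness. -/
theorem halfTrunc_reflect_sub {R : Type u} [Ring R] {n : ℕ} {p : R[X]}
    (hp : 2 * p.natDegree < n) : halfTrunc n (reflect n p - p) = -p := by
  ext i
  rw [coeff_halfTrunc, coeff_sub, coeff_neg, coeff_reflect]
  split_ifs with h
  · rw [revAt_le (by omega), coeff_eq_zero_of_natDegree_lt (n := n - i) (by omega), zero_sub]
  · rw [coeff_eq_zero_of_natDegree_lt (by omega), neg_zero]

/-- An antisymmetric `p` is the reversal of minus its low half, minus that same polynomial.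
Torsion-freeness kills the middle coefficient, which equals its own negative. -/
theorem reflect_halfTrunc_of_antisymm {R : Type u} [Ring R] [IsAddTorsionFree R] {n : ℕ} {p : R[X]}
    (hdeg : p.degree ≤ n) (hp : reflect n p = -p) :
    reflect n (-halfTrunc n p) = p + -halfTrunc n p := by
  ext i
  rw [coeff_reflect, coeff_add, coeff_neg, coeff_neg, coeff_halfTrunc, coeff_halfTrunc]
  have hi := congrArg (fun q => q.coeff i) hp
  simp only [coeff_reflect, coeff_neg] at hi
  by_cases hin : i ≤ n
  · rw [revAt_le hin] at hi ⊢
    rcases lt_trichotomy (2 * i) n with h | h | h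
    · rw [if_neg (by omega), if_pos h, neg_zero, add_neg_cancel]
    · rw [if_neg (by omega), if_neg (by omega), neg_zero, add_zero]
      rw [show n - i = i by omega] at hi
      exact (self_eq_neg.mp hi).symm
    · rw [if_pos (by omega), if_neg (by omega), hi, neg_neg, neg_zero, add_zero]
  · rw [revAt_eq_self_of_lt (by omega), if_neg (by omega), neg_zero, add_zero,
      (degree_le_iff_coeff_zero _ _).mp hdeg i (by exact_mod_cast not_le.mp hin)]

theorem eval_one_reflect {R : Type u} [CommRing R] {n : ℕ} {p : R[X]} (hp : p.natDegree ≤ n) :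
    (reflect n p).eval 1 = p.eval 1 := by
  have : Invertible (1 : R) := invertibleOne
  have := eval₂_reflect_mul_pow (RingHom.id R) 1 n p hp
  simpa [eval₂_id] using this

theorem toLaurent_reflect {R : Type u} [CommRing R] {n : ℕ} {p : R[X]} (hp : p.natDegree ≤ n) :
    toLaurent (reflect n p) = LaurentPolynomial.T n * LaurentPolynomial.invert (toLaurent p) := by
  refine induction_with_natDegree_le
    (fun p => toLaurent (reflect n p) = LaurentPolynomial.T n * LaurentPolynomial.invert (toLaurent p))
    n ?_ ?_ ?_ p hp
  · simp
  · intro i a _ hi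
    rw [reflect_C_mul_X_pow, revAt_le hi, toLaurent_C_mul_X_pow, toLaurent_C_mul_X_pow, map_mul,
      LaurentPolynomial.invert_C, LaurentPolynomial.invert_T, mul_left_comm, ← LaurentPolynomial.T_add,
      Nat.cast_sub hi, sub_eq_add_neg]
  · intro f g _ _ hf hg
    rw [reflect_add, map_add, hf, hg, map_add, map_add, mul_add]

/-- The factor `X - 1` is antisymmetric in degree one and, being monic, can be cancelled over any
commutative ring. -/
theorem eq_reflect_of_X_sub_one_mul {R : Type u} [CommRing R] {n : ℕ} {p : R[X]} (hn : 0 < n)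
    (hdeg : p.natDegree ≤ n - 1) (h : (X - 1) * p = -reflect n ((X - 1) * p)) :
    p = reflect (n - 1) p := by
  have hX : (X - 1 : R[X]).natDegree ≤ 1 := by
    rw [← C_1]; exact natDegree_X_sub_C_le 1
  have e := reflect_mul (X - 1) p hX hdeg
  rw [show 1 + (n - 1) = n by omega, reflect_sub, reflect_one_X, reflect_one, pow_one] at e
  rw [e, ← neg_mul, neg_sub] at h
  have hm : (X - 1 : R[X]).Monic := by rw [← C_1]; exact monic_X_sub_C 1
  exact hm.isRegular.left h

theorem natDegree_le_of_X_sub_one_mul {R : Type u} [CommRing R] {n : ℕ} {p : R[X]}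
    (h : ((X - 1) * p).degree ≤ (n : WithBot ℕ)) : p.natDegree ≤ n - 1 := by
  nontriviality R
  by_cases hp : p = 0
  · simp [hp]
  have hm : (X - 1 : R[X]).Monic := by rw [← C_1]; exact monic_X_sub_C 1
  have h1 := hm.natDegree_mul' hp
  have h2 : (X - 1 : R[X]).natDegree = 1 := by rw [← C_1]; exact natDegree_X_sub_C 1
  have h3 := natDegree_le_of_degree_le h
  omega

end Polynomial

/-! ### Algebra of equivariant interval functions: associativity, reversal, recursion and inverses.
-/

section IncidenceAlgebra

variable {W : Type u} [Group W] {B : Type v} [PartialOrder B] [MulAction W B]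

theorem IsWeakRankFunction.self {r : B → B → ℕ} (hr : IsWeakRankFunction r) (z : B) : r z z = 0 := by
  have := hr.add z z z le_rfl le_rfl
  omega

namespace IntervalFn

instance : Sub (IntervalFn W B) := ⟨fun p p' z z' h => p z z' h - p' z z' h⟩

instance : Neg (IntervalFn W B) := ⟨fun p z z' h => -p z z' h⟩

theorem sub_apply (p p' : IntervalFn W B) (z z' : B) (h : z ≤ z') :
    (p - p') z z' h = p z z' h - p' z z' h := rfl

theorem neg_apply (p : IntervalFn W B) (z z' : B) (h : z ≤ z') :
    (-p) z z' h = -p z z' h := rfl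

theorem char_sub (p p' : IntervalFn W B) (w : W) (z z' : B) :
    (p - p').char w z z' = p.char w z z' - p'.char w z z' := by
  by_cases h : z ≤ z' ∧ w • z = z ∧ w • z' = z'
  · rw [char_of _ h.1 h.2.1 h.2.2, char_of _ h.1 h.2.1 h.2.2, char_of _ h.1 h.2.1 h.2.2,
      ← Polynomial.map_sub]
    rfl
  · rw [char_eq_zero _ h, char_eq_zero _ h, char_eq_zero _ h, sub_zero]

theorem char_neg (p : IntervalFn W B) (w : W) (z z' : B) :
    (-p).char w z z' = -p.char w z z' := by
  by_cases h : z ≤ z' ∧ w • z = z ∧ w • z' = z'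
  · rw [char_of _ h.1 h.2.1 h.2.2, char_of _ h.1 h.2.1 h.2.2, ← Polynomial.map_neg]
    rfl
  · rw [char_eq_zero _ h, char_eq_zero _ h, neg_zero]

theorem char_rev (r : B → B → ℕ) (p : IntervalFn W B) (w : W) (z z' : B) :
    (p.rev r).char w z z' = (p.char w z z').reflect (r z z') := by
  by_cases h : z ≤ z' ∧ w • z = z ∧ w • z' = z'
  · rw [char_of _ h.1 h.2.1 h.2.2, char_of _ h.1 h.2.1 h.2.2, reflect_map]
    rfl
  · rw [char_eq_zero _ h, char_eq_zero _ h, reflect_zero]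

theorem char_tSubOneMul (p : IntervalFn W B) (w : W) (z z' : B) :
    p.tSubOneMul.char w z z' = (X - 1) * p.char w z z' := by
  by_cases h : z ≤ z' ∧ w • z = z ∧ w • z' = z'
  · rw [char_of _ h.1 h.2.1 h.2.2, char_of _ h.1 h.2.1 h.2.2, tSubOneMul, Polynomial.map_mul,
      Polynomial.map_sub, map_X, Polynomial.map_one]
  · rw [char_eq_zero _ h, char_eq_zero _ h, mul_zero]

open Classical in
theorem char_restrict (p : IntervalFn W B) (S : B → B → Prop) (w : W) (z z' : B) :
    (p.restrict S).char w z z' = if S z z' then p.char w z z' else 0 := by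
  by_cases h : z ≤ z' ∧ w • z = z ∧ w • z' = z'
  · rw [char_of _ h.1 h.2.1 h.2.2, char_of _ h.1 h.2.1 h.2.2, restrict]
    split_ifs
    · rfl
    · rw [Polynomial.map_zero]
  · rw [char_eq_zero _ h, char_eq_zero _ h, ite_self]

theorem char_self_of_memU {p : IntervalFn W B} (hp : p.MemU) {w : W} {z : B} (hz : w • z = z) :
    p.char w z z = 1 := by
  rw [char_of p le_rfl hz hz, hp, Polynomial.map_one]

theorem memU_delta : (delta : IntervalFn W B).MemU := fun _ => if_pos rfl

theorem char_delta_of_ne (w : W) {z z' : B} (h : z ≠ z') :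
    (delta : IntervalFn W B).char w z z' = 0 := by
  by_cases hh : z ≤ z' ∧ w • z = z ∧ w • z' = z'
  · rw [char_of _ hh.1 hh.2.1 hh.2.2, delta, if_neg h, Polynomial.map_zero]
  · rw [char_eq_zero _ hh]

variable [Finite W]

theorem isEquivariant_delta : (delta : IntervalFn W B).IsEquivariant := by
  refine isEquivariant_of_char fun x w z z' _ hz _ => ?_
  by_cases h : z = z'
  · subst h
    rw [char_self_of_memU memU_delta hz, char_self_of_memU memU_delta]
    rw [mul_smul, mul_smul, inv_smul_smul, hz]
  · rw [char_delta_of_ne w h, char_delta_of_ne _ fun e => h (MulAction.injective x e)]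

section Mono

variable (hmono : ∀ (w : W) (z z' : B), z ≤ z' → w • z ≤ w • z')
include hmono

theorem IsEquivariant.sub {p p' : IntervalFn W B} (hp : p.IsEquivariant) (hp' : p'.IsEquivariant) :
    (p - p').IsEquivariant :=
  isEquivariant_of_char fun x w z z' _ _ _ => by
    rw [char_sub, char_sub, hp.char_conj hmono, hp'.char_conj hmono]

theorem IsEquivariant.neg {p : IntervalFn W B} (hp : p.IsEquivariant) : (-p).IsEquivariant :=
  isEquivariant_of_char fun x w z z' _ _ _ => by
    rw [char_neg, char_neg, hp.char_conj hmono]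

theorem IsEquivariant.rev {r : B → B → ℕ}
    (hrW : ∀ (w : W) (z z' : B), z ≤ z' → r (w • z) (w • z') = r z z')
    {p : IntervalFn W B} (hp : p.IsEquivariant) : (p.rev r).IsEquivariant :=
  isEquivariant_of_char fun x w z z' hz _ _ => by
    rw [char_rev, char_rev, hp.char_conj hmono, hrW _ _ _ hz]

theorem IsEquivariant.restrict {S : B → B → Prop} (hS : ∀ (w : W) z z', S (w • z) (w • z') ↔ S z z')
    {p : IntervalFn W B} (hp : p.IsEquivariant) : (p.restrict S).IsEquivariant :=
  isEquivariant_of_char fun x w z z' hz _ _ => by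
    rw [char_restrict, char_restrict, hp.char_conj hmono]
    by_cases h : S z z'
    · rw [if_pos h, if_pos ((hS x z z').mpr h)]
    · rw [if_neg h, if_neg (mt (hS x z z').mp h)]

theorem isEquivariant_tSubOneMul_iff {p : IntervalFn W B} :
    p.tSubOneMul.IsEquivariant ↔ p.IsEquivariant := by
  constructor
  · refine fun hp => isEquivariant_of_char fun x w z z' _ _ _ => ?_
    have := hp.char_conj hmono x w z z'
    rw [char_tSubOneMul, char_tSubOneMul] at this
    refine mul_left_cancel₀ ?_ this
    rw [← C_1]
    exact X_sub_C_ne_zero 1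
  · exact fun hp => isEquivariant_of_char fun x w z z' _ _ _ => by
      rw [char_tSubOneMul, char_tSubOneMul, hp.char_conj hmono]

variable [Finite B]

theorem IsEquivariant.mul {p p' : IntervalFn W B} (hp : p.IsEquivariant) (hp' : p'.IsEquivariant) :
    (p.mul p').IsEquivariant := by
  have := Fintype.ofFinite B
  refine isEquivariant_of_char fun x w z z' _ _ _ => ?_
  rw [char_mul hmono hp hp', char_mul hmono hp hp', ← Equiv.sum_comp (MulAction.toPerm x)]
  refine Finset.sum_congr rfl fun u _ => ?_
  rw [MulAction.toPerm_apply, hp.char_conj hmono, hp'.char_conj hmono]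

theorem mul_assoc' {p₁ p₂ p₃ : IntervalFn W B} (h₁ : p₁.IsEquivariant) (h₂ : p₂.IsEquivariant)
    (h₃ : p₃.IsEquivariant) : (p₁.mul p₂).mul p₃ = p₁.mul (p₂.mul p₃) :=
  ext_toMatrix fun w => by
    rw [toMatrix_mul hmono (h₁.mul hmono h₂) h₃, toMatrix_mul hmono h₁ h₂,
      toMatrix_mul hmono h₁ (h₂.mul hmono h₃), toMatrix_mul hmono h₂ h₃, mul_assoc]

theorem mul_delta {p : IntervalFn W B} (hp : p.IsEquivariant) : p.mul delta = p :=
  ext_toMatrix fun w => by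
    classical
    rw [toMatrix_mul hmono hp isEquivariant_delta, toMatrix_delta, mul_one]

theorem delta_mul {p : IntervalFn W B} (hp : p.IsEquivariant) : delta.mul p = p :=
  ext_toMatrix fun w => by
    classical
    rw [toMatrix_mul hmono isEquivariant_delta hp, toMatrix_delta, one_mul]

theorem mul_sub' {p₁ p₂ p₃ : IntervalFn W B} (h₁ : p₁.IsEquivariant) (h₂ : p₂.IsEquivariant)
    (h₃ : p₃.IsEquivariant) : p₁.mul (p₂ - p₃) = p₁.mul p₂ - p₁.mul p₃ := by
  have := Fintype.ofFinite B
  refine ext_char fun w z z' => ?_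
  rw [char_sub, char_mul hmono h₁ (h₂.sub hmono h₃), char_mul hmono h₁ h₂, char_mul hmono h₁ h₃,
    ← Finset.sum_sub_distrib]
  simp only [char_sub, mul_sub]

theorem tSubOneMul_mul {p p' : IntervalFn W B} (hp : p.IsEquivariant) (hp' : p'.IsEquivariant) :
    (p.mul p').tSubOneMul = p.tSubOneMul.mul p' := by
  have := Fintype.ofFinite B
  refine ext_char fun w z z' => ?_
  rw [char_tSubOneMul, char_mul hmono hp hp',
    char_mul hmono ((isEquivariant_tSubOneMul_iff hmono).mpr hp) hp', Finset.mul_sum]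
  simp only [char_tSubOneMul, mul_assoc]

/-- One-sided inverses of square matrices over `ℂ[X]` are two-sided. -/
theorem mul_left_inv_of_right_inv {p p' : IntervalFn W B} (hp : p.IsEquivariant)
    (hp' : p'.IsEquivariant) (h : p.mul p' = delta) : p'.mul p = delta :=
  ext_toMatrix fun w => by
    classical
    have e := congrArg (fun q => q.toMatrix w) h
    rw [toMatrix_mul hmono hp hp', toMatrix_delta] at e
    rw [toMatrix_mul hmono hp' hp, toMatrix_delta]
    exact mul_eq_one_comm.mp e

/-- Triangularity: when `k` vanishes at `[z', z']`, the term `u = z'` drops out. This is what makes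
the recursions below well founded. -/
theorem mul_congr_of_lt {p p' k : IntervalFn W B} (hp : p.IsEquivariant) (hp' : p'.IsEquivariant)
    (hk : k.IsEquivariant) {z z' : B} (hz : z ≤ z') (hkz : k z' z' le_rfl = 0)
    (h : ∀ u hu, u < z' → p z u hu = p' z u hu) : p.mul k z z' hz = p'.mul k z z' hz := by
  have := Fintype.ofFinite B
  refine ext_char_apply hz fun w => ?_
  rw [char_mul hmono hp hk, char_mul hmono hp' hk]
  refine Finset.sum_congr rfl fun u _ => ?_
  by_cases hu : u < z'
  · rw [char_congr (fun hzu => h u hzu hu)]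
  · have : k.char w u z' = 0 := by
      by_cases hh : u ≤ z' ∧ w • u = u ∧ w • z' = z'
      · obtain rfl : u = z' := hh.1.eq_of_not_lt hu
        rw [char_of k le_rfl hh.2.1 hh.2.2, hkz, Polynomial.map_zero]
      · exact char_eq_zero _ hh
    rw [this, mul_zero, mul_zero]

end Mono

/-- Degree bounds can be tested on characters, since a coefficient with all characters zero is zero.
-/
theorem memI_iff_char {r : B → B → ℕ} {p : IntervalFn W B} :
    p.MemI r ↔ p.IsEquivariant ∧ ∀ w z z', (p.char w z z').degree ≤ r z z' := by
  refine and_congr_right fun _ => ⟨fun h w z z' => ?_, fun h z z' hz => ?_⟩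
  · by_cases hh : z ≤ z' ∧ w • z = z ∧ w • z' = z'
    · rw [char_of p hh.1 hh.2.1 hh.2.2]
      exact degree_map_le.trans (h _ _ _)
    · rw [char_eq_zero _ hh, degree_zero]; exact bot_le
  · refine degree_le_of_ev fun g => ?_
    rw [← char_of p hz g.2.1 g.2.2]
    exact h _ _ _

theorem memI_delta {r : B → B → ℕ} : (delta : IntervalFn W B).MemI r := by
  refine ⟨isEquivariant_delta, fun z z' _ => ?_⟩
  rw [delta]
  split_ifs
  · exact degree_one_le.trans (by exact_mod_cast Nat.zero_le _)
  · rw [degree_zero]; exact bot_le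

section MemI

variable (hmono : ∀ (w : W) (z z' : B), z ≤ z' → w • z ≤ w • z')
include hmono

theorem MemI.sub {r : B → B → ℕ} {p p' : IntervalFn W B} (hp : p.MemI r) (hp' : p'.MemI r) :
    (p - p').MemI r :=
  ⟨hp.1.sub hmono hp'.1, fun z z' hz =>
    (degree_sub_le _ _).trans (max_le (hp.2 z z' hz) (hp'.2 z z' hz))⟩

theorem MemI.rev {r : B → B → ℕ}
    (hrW : ∀ (w : W) (z z' : B), z ≤ z' → r (w • z) (w • z') = r z z')
    {p : IntervalFn W B} (hp : p.MemI r) : (p.rev r).MemI r :=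
  ⟨hp.1.rev hmono hrW, fun z z' hz => degree_reflect_le (hp.2 z z' hz)⟩

theorem MemI.restrict {r : B → B → ℕ} {S : B → B → Prop}
    (hS : ∀ (w : W) z z', S (w • z) (w • z') ↔ S z z')
    {p : IntervalFn W B} (hp : p.MemI r) : (p.restrict S).MemI r := by
  refine ⟨hp.1.restrict hmono hS, fun z z' hz => ?_⟩
  rw [IntervalFn.restrict]
  split_ifs
  · exact hp.2 z z' hz
  · rw [degree_zero]; exact bot_le

variable [Finite B]

theorem MemI.mul {r : B → B → ℕ} (hr : IsWeakRankFunction r) {p p' : IntervalFn W B}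
    (hp : p.MemI r) (hp' : p'.MemI r) : (p.mul p').MemI r := by
  have := Fintype.ofFinite B
  rw [memI_iff_char] at hp hp' ⊢
  refine ⟨hp.1.mul hmono hp'.1, fun w z z' => ?_⟩
  rw [char_mul hmono hp.1 hp'.1, ← mem_degreeLE]
  refine Submodule.sum_mem _ fun u _ => ?_
  rw [mem_degreeLE]
  by_cases h : z ≤ u ∧ u ≤ z'
  · refine (degree_mul_le_of_le (hp.2 w z u) (hp'.2 w u z')).trans ?_
    rw [hr.add z u z' h.1 h.2, Nat.cast_add]
  · have : p.char w z u * p'.char w u z' = 0 := by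
      by_cases h1 : z ≤ u
      · rw [char_eq_zero p' fun hh => h ⟨h1, hh.1⟩, mul_zero]
      · rw [char_eq_zero p fun hh => h1 hh.1, zero_mul]
    rw [this, degree_zero]; exact bot_le

/-- Additivity of `r` along `z ≤ u ≤ z'` splits the reversal of each term; the degree bounds are
needed for reversal to be multiplicative. -/
theorem rev_mul {r : B → B → ℕ} (hr : IsWeakRankFunction r)
    (hrW : ∀ (w : W) (z z' : B), z ≤ z' → r (w • z) (w • z') = r z z') {p p' : IntervalFn W B}
    (hp : p.MemI r) (hp' : p'.MemI r) : (p.mul p').rev r = (p.rev r).mul (p'.rev r) := by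
  have := Fintype.ofFinite B
  refine ext_char fun w z z' => ?_
  rw [char_rev, char_mul hmono hp.1 hp'.1, char_mul hmono (hp.1.rev hmono hrW)
    (hp'.1.rev hmono hrW), reflect_sum]
  refine Finset.sum_congr rfl fun u _ => ?_
  rw [char_rev, char_rev]
  rw [memI_iff_char] at hp hp'
  by_cases h : z ≤ u ∧ u ≤ z'
  · rw [hr.add z u z' h.1 h.2, reflect_mul _ _ (natDegree_le_of_degree_le (hp.2 w z u))
      (natDegree_le_of_degree_le (hp'.2 w u z'))]
  · by_cases h1 : z ≤ u
    · rw [char_eq_zero p' fun hh => h ⟨h1, hh.1⟩, mul_zero, reflect_zero, reflect_zero, mul_zero]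
    · rw [char_eq_zero p fun hh => h1 hh.1, zero_mul, reflect_zero, reflect_zero, zero_mul]

end MemI

omit [Finite W] in
theorem rev_delta {r : B → B → ℕ} (hr : IsWeakRankFunction r) :
    (delta : IntervalFn W B).rev r = delta := by
  funext z z' hz
  rw [rev, delta]
  split_ifs with h
  · subst h
    rw [hr.self, reflect_one, pow_zero]
  · exact reflect_zero

omit [Finite W] in
theorem rev_sub {r : B → B → ℕ} (p p' : IntervalFn W B) :
    (p - p').rev r = p.rev r - p'.rev r := by
  funext z z' hz
  exact reflect_sub _ _ _

omit [Finite W] in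
/-- An operator on interval functions whose value at `[z, z']` depends only on the values at the
intervals `[z, u]` with `u < z'` has a unique fixed point. -/
theorem existsUnique_fixedPoint [Finite B] {r : B → B → ℕ} (hr : IsWeakRankFunction r)
    {P : IntervalFn W B → Prop} {T : IntervalFn W B → IntervalFn W B} (hne : ∃ p, P p)
    (hP : ∀ p, P p → P (T p))
    (hT : ∀ p p', P p → P p' → ∀ z z' hz, (∀ u hu, u < z' → p z u hu = p' z u hu) →
      T p z z' hz = T p' z z' hz) : ∃! p, P p ∧ T p = p := by
  have := Fintype.ofFinite B
  have hPn : ∀ n p, P p → P (T^[n] p) := fun n => by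
    induction n with
    | zero => exact fun p hp => hp
    | succ n ih => exact fun p hp => ih _ (hP p hp)
  -- After `n` iterations, the values on intervals of weak rank below `n` no longer depend on the
  -- starting point.
  have key : ∀ n p p', P p → P p' → ∀ z z' hz, r z z' < n →
      (T^[n]) p z z' hz = (T^[n]) p' z z' hz := fun n p p' hp hp' => by
    induction n with
    | zero => exact fun _ _ _ h => absurd h (Nat.not_lt_zero _)
    | succ n ih =>
      intro z z' hz h
      rw [Function.iterate_succ_apply', Function.iterate_succ_apply']
      refine hT _ _ (hPn n p hp) (hPn n p' hp') z z' hz fun u hu hlt => ih z u hu ?_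
      have h1 := hr.add z u z' hu hlt.le
      have h2 := hr.pos u z' hlt
      omega
  obtain ⟨N, hN⟩ : ∃ N, ∀ z z', r z z' < N := by
    refine ⟨∑ x : B × B, r x.1 x.2 + 1, fun z z' => Nat.lt_succ_of_le ?_⟩
    exact Finset.single_le_sum (f := fun x : B × B => r x.1 x.2) (fun _ _ => Nat.zero_le _)
      (Finset.mem_univ (z, z'))
  obtain ⟨p, hp⟩ := hne
  refine ⟨T^[N] p, ⟨hPn N p hp, ?_⟩, fun p' hp' => ?_⟩
  · rw [← Function.iterate_succ_apply' T, Function.iterate_succ_apply]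
    funext z z' hz
    exact key N _ _ (hP p hp) hp z z' hz (hN z z')
  · rw [← Function.iterate_fixed hp'.2 N]
    funext z z' hz
    exact key N _ _ hp'.1 hp z z' hz (hN z z')

section Inverse

variable (hmono : ∀ (w : W) (z z' : B), z ≤ z' → w • z ≤ w • z') [Finite B]
include hmono

theorem IsInverse.eq {p p₁ p₂ : IntervalFn W B} (hp : p.IsEquivariant) (h₁ : IsInverse p p₁)
    (h₂ : IsInverse p p₂) : p₁ = p₂ := by
  rw [← mul_delta hmono h₁.1, ← h₂.2.1, ← mul_assoc' hmono h₁.1 hp h₂.1, h₁.2.2,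
    delta_mul hmono h₂.1]

/-- Elements of `𝓘^W(B) ∩ U^W(B)` have inverses in `𝓘^W(B)`. -/
theorem exists_isInverse {r : B → B → ℕ} (hr : IsWeakRankFunction r) {p : IntervalFn W B}
    (hp : p.MemI r) (hpU : p.MemU) : ∃ p', IsInverse p p' ∧ p'.MemI r := by
  have hk := hp.sub hmono (memI_delta (r := r))
  have hk0 : ∀ z, (p - delta : IntervalFn W B) z z le_rfl = 0 := fun z => by
    change p z z le_rfl - delta z z le_rfl = 0
    rw [hpU, memU_delta, sub_self]
  -- The fixed-point equation `p' = δ - p' (p - δ)` says `p' p = δ`; iterating inside `MemI` gives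
  -- the degree bound on the inverse for free.
  obtain ⟨p', ⟨hp'1, hp'2⟩, -⟩ := existsUnique_fixedPoint hr (P := fun p' => p'.MemI r)
    (T := fun p' => delta - p'.mul (p - delta)) ⟨delta, memI_delta⟩
    (fun p' hp' => memI_delta.sub hmono (hp'.mul hmono hr hk))
    (fun p₁ p₂ h₁ h₂ z z' hz h => congrArg (delta z z' hz - ·)
      (mul_congr_of_lt hmono h₁.1 h₂.1 hk.1 hz (hk0 z') h))
  have e : p'.mul p = delta := by
    rw [mul_sub' hmono hp'1.1 hp.1 isEquivariant_delta, mul_delta hmono hp'1.1] at hp'2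
    funext z z' hz
    have h := congrFun (congrFun (congrFun hp'2 z) z') hz
    rw [sub_apply, sub_apply] at h
    rw [← sub_eq_zero, ← sub_eq_zero.mpr h.symm]
    abel
  exact ⟨p', ⟨hp'1.1, mul_left_inv_of_right_inv hmono hp'1.1 hp.1 e, e⟩, hp'1⟩

end Inverse

end IntervalFn

end IncidenceAlgebra

/-! ### Sign cancellation over the fibres of `z ↦ z ∨ q`. -/

section LowerEulerian

/-- In a lower Eulerian poset with a join-admissible element `q`, if `z` is not above `q` and
`z ∨ q ≤ y`, then the signs of the elements `u ≥ z` with `u ∨ q = y` sum to zero. -/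
theorem sum_sign_join_eq_zero {P : Type u} [PartialOrder P] [Fintype P] [DecidableEq P]
    [DecidableLE P] {s : P → ℤ}
    (hs : ∀ z z' : P, z < z' → ∑ u, (if z ≤ u ∧ u ≤ z' then s u else 0) = 0)
    {q : P} {σ : P → P} (hσ : ∀ z, IsLUB {z, q} (σ z)) {z : P} (hz : ¬ q ≤ z) (y : P)
    (hy : σ z ≤ y) : ∑ u, (if z ≤ u ∧ σ u = y then s u else 0) = 0 := by
  have hle : ∀ u, u ≤ σ u := fun u => (hσ u).1 (by simp)
  have hq : ∀ u, q ≤ σ u := fun u => (hσ u).1 (by simp)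
  have hσle : ∀ u v, u ≤ v → q ≤ v → σ u ≤ v := fun u v h1 h2 => (hσ u).2 (by
    rintro a (rfl | rfl)
    exacts [h1, h2])
  induction y using WellFoundedLT.induction with
  | ind y ih =>
  have hzy : z < y := lt_of_le_of_ne ((hle z).trans hy) fun e => hz (e ▸ (hq z).trans hy)
  have hqy : q ≤ y := (hq z).trans hy
  refine Eq.trans (Eq.symm ?_) (hs z y hzy)
  -- Elements of `[z, y]` are sorted by their join `v = u ∨ q`, which is still at most `y`. By
  -- induction, or because the fibre is empty, only `v = y` survives.
  have e1 : ∀ u, (if z ≤ u ∧ u ≤ y then s u else 0) =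
      ∑ v, if v ≤ y then (if z ≤ u ∧ σ u = v then s u else 0) else 0 := fun u => by
    rw [Finset.sum_eq_single (σ u)]
    · by_cases h1 : z ≤ u
      · by_cases h2 : u ≤ y
        · simp [h1, h2, hσle u y h2 hqy]
        · have h3 : ¬ σ u ≤ y := fun h => h2 ((hle u).trans h)
          simp [h2, h3]
      · simp [h1]
    · intro v _ hv
      simp [hv.symm]
    · intro h; exact absurd (Finset.mem_univ _) h
  rw [Finset.sum_congr rfl fun u _ => e1 u, Finset.sum_comm, Finset.sum_eq_single y]
  · simp
  · intro v _ hv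
    by_cases hvy : v ≤ y
    · simp only [hvy, if_true]
      by_cases hzv : σ z ≤ v
      · exact ih v (lt_of_le_of_ne hvy hv) hzv
      · refine Finset.sum_eq_zero fun u _ => if_neg ?_
        rintro ⟨h1, rfl⟩
        exact hzv (hσle z _ (h1.trans (hle u)) (hq u))
    · simp [hvy]
  · intro h; exact absurd (Finset.mem_univ _) h

/-- Elements above `q` equal their own join, so the full fibre over `y` is its part not above `q`
together with `y`; the full sum vanishes by `sum_sign_join_eq_zero`. -/
theorem sum_sign_lower_join {P : Type u} [PartialOrder P] [Fintype P] [DecidableEq P]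
    [DecidableLE P] {s : P → ℤ}
    (hs : ∀ z z' : P, z < z' → ∑ u, (if z ≤ u ∧ u ≤ z' then s u else 0) = 0)
    {q : P} {σ : P → P} (hσ : ∀ z, IsLUB {z, q} (σ z)) (z y : P) :
    ∑ u, (if z ≤ u ∧ ¬ q ≤ u ∧ y = σ u then s u else 0) =
      if ¬ q ≤ z ∧ σ z ≤ y then -s y else 0 := by
  have hle : ∀ u, u ≤ σ u := fun u => (hσ u).1 (by simp)
  have hq : ∀ u, q ≤ σ u := fun u => (hσ u).1 (by simp)
  have hσle : ∀ u v, u ≤ v → q ≤ v → σ u ≤ v := fun u v h1 h2 => (hσ u).2 (by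
    rintro a (rfl | rfl)
    exacts [h1, h2])
  split_ifs with h
  · have hqy : q ≤ y := (hq z).trans h.2
    have hy : σ y = y := le_antisymm (hσle y y le_rfl hqy) (hle y)
    have hzy : z ≤ y := (hle z).trans h.2
    rw [eq_neg_iff_add_eq_zero]
    refine Eq.trans ?_ (sum_sign_join_eq_zero hs hσ h.1 y h.2)
    rw [show s y = ∑ u, if u = y then s u else 0 by simp, ← Finset.sum_add_distrib]
    refine Finset.sum_congr rfl fun u _ => ?_
    by_cases hu : q ≤ u
    · have hu' : σ u = u := le_antisymm (hσle u u le_rfl hu) (hle u)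
      by_cases huy : u = y
      · subst huy; simp [hu, hzy, hy]
      · simp [hu, hu', huy]
    · have huy : u ≠ y := fun e => hu (e ▸ hqy)
      simp [hu, huy, eq_comm]
  · refine Finset.sum_eq_zero fun u _ => if_neg ?_
    rintro ⟨h1, h2, rfl⟩
    exact h ⟨fun hqz => h2 (hqz.trans h1), hσle z _ (h1.trans (hle u)) (hq u)⟩

open Classical in
theorem sum_Icc_sign {P : Type u} [PartialOrder P] [Fintype P] {ρ : P → ℤ}
    (h : ∀ z z' : P, z < z' → ∑ᶠ z'' ∈ Set.Icc z z', ((ρ z'').negOnePow : ℤ) = 0) (z z' : P)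
    (hz : z < z') : ∑ u, (if z ≤ u ∧ u ≤ z' then ((ρ u).negOnePow : ℤ) else 0) = 0 := by
  refine Eq.trans ?_ (h z z' hz)
  rw [finsum_mem_def, finsum_eq_sum_of_fintype]
  refine Finset.sum_congr rfl fun u _ => ?_
  rw [Set.indicator_apply]
  rfl

end LowerEulerian

/-! ### Multiplicative rank alternating functions, and the identity `κ a^rev = -a κ`. -/

section Kernel

variable {W : Type u} [Group W] {B : Type v} [PartialOrder B] [MulAction W B]

theorem smul_sigma (hmono : ∀ (w : W) (z z' : B), z ≤ z' → w • z ≤ w • z') {q : B}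
    (hq : IsJoinAdmissible q) (hqW : ∀ w : W, w • q = q) (w : W) (z : B) :
    w • sigma hq z = sigma hq (w • z) := by
  have hle : ∀ w : W, sigma hq (w • z) ≤ w • sigma hq z := fun w =>
    (sigma_isLUB hq (w • z)).2 (by
      rintro a (rfl | rfl)
      · exact hmono _ _ _ (le_sigma hq z)
      · have := hmono w _ _ ((sigma_isLUB hq z).1 (show a ∈ ({z, a} : Set B) by simp))
        rwa [hqW] at this)
  refine le_antisymm ?_ (hle w)
  have : sigma hq z ≤ w⁻¹ • sigma hq (w • z) := (sigma_isLUB hq z).2 (by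
    rintro a (rfl | rfl)
    · have := hmono w⁻¹ _ _ (le_sigma hq (w • a))
      rwa [inv_smul_smul] at this
    · have := hmono w⁻¹ _ _ ((sigma_isLUB hq (w • z)).1 (show a ∈ ({w • z, a} : Set B) by simp))
      rwa [hqW] at this)
  have := hmono w _ _ this
  rwa [smul_inv_smul] at this

theorem le_of_sigma_eq {q : B} (hq : IsJoinAdmissible q) (z : B) : q ≤ sigma hq z :=
  (sigma_isLUB hq z).1 (by simp)

theorem smul_mem_lowerPart (hmono : ∀ (w : W) (z z' : B), z ≤ z' → w • z ≤ w • z') {q : B}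
    (hqW : ∀ w : W, w • q = q) (w : W) (z : B) : w • z ∈ lowerPart q ↔ z ∈ lowerPart q := by
  refine not_congr ⟨fun h => ?_, fun h => ?_⟩
  · have := hmono w⁻¹ _ _ h
    rwa [inv_smul_smul, hqW] at this
  · have := hmono w _ _ h
    rwa [hqW] at this

/-- The join with `q` on the fixed points of `w`. -/
def fixedSigma (hmono : ∀ (w : W) (z z' : B), z ≤ z' → w • z ≤ w • z') {q : B}
    (hq : IsJoinAdmissible q) (hqW : ∀ w : W, w • q = q) (w : W) (z : MulAction.fixedBy B w) :
    MulAction.fixedBy B w :=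
  ⟨sigma hq z, by
    have hz : w • (z : B) = z := z.2
    rw [MulAction.mem_fixedBy, smul_sigma hmono hq hqW, hz]⟩

theorem fixedSigma_isLUB (hmono : ∀ (w : W) (z z' : B), z ≤ z' → w • z ≤ w • z') {q : B}
    (hq : IsJoinAdmissible q) (hqW : ∀ w : W, w • q = q) (w : W) (z : MulAction.fixedBy B w) :
    IsLUB {z, (⟨q, hqW w⟩ : MulAction.fixedBy B w)} (fixedSigma hmono hq hqW w z) := by
  constructor
  · rintro a (rfl | rfl)
    · exact le_sigma hq (a : B)
    · exact le_of_sigma_eq hq (z : B)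
  · intro b hb
    refine (sigma_isLUB hq (z : B)).2 ?_
    rintro a (rfl | rfl)
    · exact hb (Set.mem_insert _ _)
    · exact hb (Set.mem_insert_of_mem _ rfl)

namespace IntervalFn

variable {r : B → B → ℕ} {κ : IntervalFn W B}

theorem IsMultiplicative.toMatrix_mul (hκm : κ.IsMultiplicative) {w : W}
    {z u z' : MulAction.fixedBy B w} (h : z ≤ u) (h' : u ≤ z') :
    κ.toMatrix w z u * κ.toMatrix w u z' = κ.toMatrix w z z' := by
  rw [toMatrix_apply_of_le _ _ _ _ h, toMatrix_apply_of_le _ _ _ _ h',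
    toMatrix_apply_of_le _ _ _ _ (h.trans h'), hκm w z u z' h h']

theorem IsRankAlternating.toMatrix_rev (hκa : κ.IsRankAlternating r) {w : W}
    {ρ : MulAction.fixedBy B w → ℤ} (hρ : IsRankFunction ρ) {z z' : MulAction.fixedBy B w}
    (h : z ≤ z') :
    (κ.rev r).toMatrix w z z' = ((ρ z' - ρ z).negOnePow : ℤ) • κ.toMatrix w z z' := by
  rw [toMatrix_apply_of_le _ _ _ _ h, toMatrix_apply_of_le _ _ _ _ h, hκa w ρ hρ z z' h]

/-- The dependence on the middle element `u` is only a sign, so convolutions of `κ` with `κ^rev`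
become sign sums. -/
theorem toMatrix_mul_toMatrix_rev (hκm : κ.IsMultiplicative) (hκa : κ.IsRankAlternating r) {w : W}
    {ρ : MulAction.fixedBy B w → ℤ} (hρ : IsRankFunction ρ) {z u z' : MulAction.fixedBy B w}
    (h : z ≤ u) (h' : u ≤ z') :
    κ.toMatrix w z u * (κ.rev r).toMatrix w u z' =
      (((ρ z').negOnePow : ℤ) * (ρ u).negOnePow) • κ.toMatrix w z z' := by
  rw [hκa.toMatrix_rev hρ h', mul_smul_comm, hκm.toMatrix_mul h h', Int.negOnePow_sub]
  rfl

/-- On a cover the sign is `-1`, while reversal preserves the value at `1`, so that value is its own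
negative. Multiplicativity carries the zero to any interval that starts with the cover. -/
theorem eval_one_toMatrix [Finite B] (hκ : κ.MemI r) (hκm : κ.IsMultiplicative)
    (hκa : κ.IsRankAlternating r) {w : W}
    {ρ : MulAction.fixedBy B w → ℤ} (hρ : IsRankFunction ρ) {z z' : MulAction.fixedBy B w}
    (h : z < z') : (κ.toMatrix w z z').eval 1 = 0 := by
  obtain ⟨u, hu, hu'⟩ := exists_covBy_le_of_lt h
  rw [← hκm.toMatrix_mul hu.le hu', eval_mul]
  have e := hκa.toMatrix_rev hρ hu.le
  rw [hρ z u hu, add_sub_cancel_left, Int.negOnePow_one, toMatrix_apply, char_rev,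
    ← toMatrix_apply] at e
  have e1 := congrArg (eval 1) e
  rw [eval_one_reflect] at e1
  · have e2 : eval 1 (κ.toMatrix w z u) = -eval 1 (κ.toMatrix w z u) := by
      simpa using e1
    rw [self_eq_neg.mp e2, zero_mul]
  · rw [toMatrix_apply_of_le _ _ _ _ hu.le]
    exact natDegree_le_of_degree_le (degree_map_le.trans (hκ.2 _ _ _))

variable [Finite W] [Finite B]
variable (hmono : ∀ (w : W) (z z' : B), z ≤ z' → w • z ≤ w • z')
include hmono

/-- A multiplicative rank alternating element is a kernel. -/
theorem mul_rev_eq_delta (hr : IsWeakRankFunction r)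
    (hrW : ∀ (w : W) (z z' : B), z ≤ z' → r (w • z) (w • z') = r z z')
    (hW : IsEulerianAction W B) (hκ : κ.MemI r) (hκU : κ.MemU)
    (hκm : κ.IsMultiplicative) (hκa : κ.IsRankAlternating r) : κ.mul (κ.rev r) = delta := by
  classical
  refine ext_toMatrix fun w => ?_
  obtain ⟨-, ρ, hρ, hE⟩ := hW w
  rw [toMatrix_mul hmono hκ.1 (hκ.rev hmono hrW).1, toMatrix_delta]
  ext1 z z'
  have e : ∀ u, κ.toMatrix w z u * (κ.rev r).toMatrix w u z' =
      (((ρ z').negOnePow : ℤ) * (if z ≤ u ∧ u ≤ z' then ((ρ u).negOnePow : ℤ) else 0)) •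
        κ.toMatrix w z z' := fun u => by
    split_ifs with h
    · exact toMatrix_mul_toMatrix_rev hκm hκa hρ h.1 h.2
    · rw [mul_zero, zero_smul]
      by_cases h1 : z ≤ u
      · rw [toMatrix_apply_of_not_le (κ.rev r) _ _ _ fun h2 => h ⟨h1, h2⟩, mul_zero]
      · rw [toMatrix_apply_of_not_le κ _ _ _ h1, zero_mul]
  rw [Matrix.mul_apply]
  by_cases hzz : z = z'
  · subst hzz
    rw [Matrix.one_apply_eq, Finset.sum_eq_single z]
    · rw [toMatrix_apply, toMatrix_apply, char_rev, char_self_of_memU hκU z.2, hr.self,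
        reflect_one, pow_zero, one_mul]
    · intro u _ hu
      rw [e, if_neg fun h => hu (le_antisymm h.2 h.1), mul_zero, zero_smul]
    · intro h; exact absurd (Finset.mem_univ _) h
  · rw [Matrix.one_apply_ne hzz]
    by_cases hle : z ≤ z'
    · rw [Finset.sum_congr rfl fun u _ => e u, ← Finset.sum_smul, ← Finset.mul_sum,
        sum_Icc_sign hE z z' (lt_of_le_of_ne hle hzz), mul_zero, zero_smul]
    · refine Finset.sum_eq_zero fun u _ => ?_
      rw [e, if_neg fun h => hle (h.1.trans h.2), mul_zero, zero_smul]

/-- The set `(X/Y)°` of intervals `[x, σ(x)]` with `x ∈ X`. -/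
abbrev joinIntervals {q : B} (hq : IsJoinAdmissible q) : B → B → Prop :=
  fun z z' => z ∈ lowerPart q ∧ z' = sigma hq z

omit [Finite W] [Finite B] in
theorem joinIntervals_smul {q : B} (hq : IsJoinAdmissible q) (hqW : ∀ w : W, w • q = q) (w : W)
    (z z' : B) : joinIntervals hq (w • z) (w • z') ↔ joinIntervals hq z z' := by
  refine and_congr (smul_mem_lowerPart hmono hqW w z) ?_
  rw [← smul_sigma hmono hq hqW]
  exact (MulAction.injective w).eq_iff

/-- The combinatorial heart. On `Γ^w` the left side is `κ(a, b)` times the signed count of the `u`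
not above `q` with `a ≤ u` and `u ∨ q = b`; on the right only the middle element `a ∨ q`
contributes. -/
theorem mul_rev_restrict {q : B} (hq : IsJoinAdmissible q) (hqW : ∀ w : W, w • q = q)
    (hrW : ∀ (w : W) (z z' : B), z ≤ z' → r (w • z) (w • z') = r z z')
    (hW : IsEulerianAction W B) (hκ : κ.MemI r)
    (hκm : κ.IsMultiplicative) (hκa : κ.IsRankAlternating r) :
    κ.mul ((κ.restrict (joinIntervals hq)).rev r) =
      -((κ.restrict (joinIntervals hq)).mul κ) := by
  classical
  refine ext_char fun w z z' => ?_
  by_cases hh : z ≤ z' ∧ w • z = z ∧ w • z' = z'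
  swap
  · rw [char_eq_zero _ hh, char_eq_zero _ hh]
  have hκX := hκ.restrict hmono (joinIntervals_smul hmono hq hqW)
  obtain ⟨-, ρ, hρ, hE⟩ := hW w
  rw [char_neg]
  change (κ.mul ((κ.restrict (joinIntervals hq)).rev r)).toMatrix w ⟨z, hh.2.1⟩ ⟨z', hh.2.2⟩ =
    -((κ.restrict (joinIntervals hq)).mul κ).toMatrix w ⟨z, hh.2.1⟩ ⟨z', hh.2.2⟩
  generalize (⟨z, hh.2.1⟩ : MulAction.fixedBy B w) = a
  generalize (⟨z', hh.2.2⟩ : MulAction.fixedBy B w) = b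
  rw [IntervalFn.toMatrix_mul hmono hκ.1 (hκX.rev hmono hrW).1,
    IntervalFn.toMatrix_mul hmono hκX.1 hκ.1, Matrix.mul_apply, Matrix.mul_apply]
  set q' : MulAction.fixedBy B w := ⟨q, hqW w⟩ with hq'
  set σ := fixedSigma hmono hq hqW w with hσ
  have hσL := fixedSigma_isLUB hmono hq hqW w
  have hS : ∀ u v : MulAction.fixedBy B w, joinIntervals hq (u : B) v ↔ (¬ q' ≤ u ∧ v = σ u) :=
    fun u v => and_congr Iff.rfl (Subtype.ext_iff (a1 := v) (a2 := σ u)).symm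
  have hleσ : ∀ u, u ≤ σ u := fun u => le_sigma hq (u : B)
  have e : ∀ u, κ.toMatrix w a u * ((κ.restrict (joinIntervals hq)).rev r).toMatrix w u b =
      (((ρ b).negOnePow : ℤ) * (if a ≤ u ∧ ¬ q' ≤ u ∧ b = σ u then ((ρ u).negOnePow : ℤ) else 0)) •
        κ.toMatrix w a b := fun u => by
    rw [toMatrix_apply (rev _ _), char_rev, char_restrict]
    by_cases hu : joinIntervals hq (u : B) b
    · have hu' := (hS u b).mp hu
      have hub : u ≤ b := hu'.2 ▸ hleσ u
      rw [if_pos hu, ← char_rev, ← toMatrix_apply]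
      by_cases hau : a ≤ u
      · rw [if_pos ⟨hau, hu'⟩]
        exact toMatrix_mul_toMatrix_rev hκm hκa hρ hau hub
      · rw [toMatrix_apply_of_not_le κ _ _ _ hau, zero_mul, if_neg fun h => hau h.1, mul_zero,
          zero_smul]
    · rw [if_neg hu, reflect_zero, mul_zero, if_neg fun h => hu ((hS u b).mpr h.2), mul_zero,
        zero_smul]
  rw [Finset.sum_congr rfl fun u _ => e u, ← Finset.sum_smul, ← Finset.mul_sum,
    sum_sign_lower_join (sum_Icc_sign hE) hσL a b]
  have e' : ∑ u, (κ.restrict (joinIntervals hq)).toMatrix w a u * κ.toMatrix w u b =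
      if ¬ q' ≤ a ∧ σ a ≤ b then κ.toMatrix w a b else 0 := by
    rw [Finset.sum_eq_single (σ a)]
    · rw [toMatrix_apply (restrict _ _), char_restrict]
      by_cases ha : q' ≤ a
      · rw [if_neg fun h => h.1 ha, if_neg fun h => h.1 ha, zero_mul]
      · rw [if_pos ((hS a (σ a)).mpr ⟨ha, rfl⟩), ← toMatrix_apply]
        by_cases hb : σ a ≤ b
        · rw [if_pos ⟨ha, hb⟩, hκm.toMatrix_mul (hleσ a) hb]
        · rw [if_neg fun h => hb h.2, toMatrix_apply_of_not_le _ _ _ _ hb, mul_zero]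
    · intro u _ hu
      rw [toMatrix_apply (restrict _ _), char_restrict, if_neg fun h => hu ((hS a u).mp h).2,
        zero_mul]
    · intro h; exact absurd (Finset.mem_univ _) h
  rw [e']
  split_ifs
  -- The sign sum is `-(-1)^ρ(b)`, and the two factors `(-1)^ρ(b)` cancel.
  · rw [mul_neg, neg_smul, ← Units.val_mul, Int.units_mul_self, Units.val_one, one_smul]
  · rw [mul_zero, zero_smul, neg_zero]

end IntervalFn

end Kernel

/-! ### The left Kazhdan-Lusztig-Stanley function, the `h`-polynomials and antisymmetry. -/

section KazhdanLusztigStanley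

variable {W : Type u} [Group W] [Finite W] {B : Type v} [PartialOrder B] [Finite B] [MulAction W B]

namespace IntervalFn

variable {r : B → B → ℕ} {κ : IntervalFn W B}

open Classical in
/-- The operator whose fixed point is the left Kazhdan-Lusztig-Stanley function of `κ`. -/
def klsStep (r : B → B → ℕ) (κ p : IntervalFn W B) : IntervalFn W B := fun z z' hz =>
  if z = z' then 1 else -halfTrunc (r z z') (p.mul (κ - delta) z z' hz)

omit [Finite B] in
theorem klsStep_self (r : B → B → ℕ) (κ p : IntervalFn W B) : (klsStep r κ p).MemU :=
  fun _ => if_pos rfl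

omit [Finite B] in
theorem klsStep_of_ne (r : B → B → ℕ) (κ p : IntervalFn W B) {z z' : B} (hz : z ≤ z')
    (h : z ≠ z') : klsStep r κ p z z' hz = -halfTrunc (r z z') (p.mul (κ - delta) z z' hz) :=
  if_neg h

omit [Finite B] in
theorem char_klsStep_of_ne (r : B → B → ℕ) (κ p : IntervalFn W B) (w : W) {z z' : B}
    (h : z ≠ z') : (klsStep r κ p).char w z z' =
      -halfTrunc (r z z') ((p.mul (κ - delta)).char w z z') := by
  by_cases hh : z ≤ z' ∧ w • z = z ∧ w • z' = z'
  · rw [char_of _ hh.1 hh.2.1 hh.2.2, char_of _ hh.1 hh.2.1 hh.2.2, klsStep_of_ne _ _ _ _ h,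
      Polynomial.map_neg, map_halfTrunc]
  · rw [char_eq_zero _ hh, char_eq_zero _ hh]
    ext i
    simp [coeff_halfTrunc]

omit [Finite W] [Finite B] in
theorem sub_delta_self (hκU : κ.MemU) (z : B) : (κ - delta : IntervalFn W B) z z le_rfl = 0 := by
  rw [sub_apply, hκU, memU_delta, sub_self]

variable (hmono : ∀ (w : W) (z z' : B), z ≤ z' → w • z ≤ w • z')
include hmono

theorem isEquivariant_klsStep (hrW : ∀ (w : W) (z z' : B), z ≤ z' → r (w • z) (w • z') = r z z')
    (hκ : κ.IsEquivariant) {p : IntervalFn W B} (hp : p.IsEquivariant) :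
    (klsStep r κ p).IsEquivariant := by
  refine isEquivariant_of_char fun x w z z' hz hwz _ => ?_
  by_cases h : z = z'
  · subst h
    rw [char_self_of_memU (klsStep_self r κ p) hwz, char_self_of_memU (klsStep_self r κ p)]
    rw [mul_smul, mul_smul, inv_smul_smul, hwz]
  · rw [char_klsStep_of_ne _ _ _ _ h,
      char_klsStep_of_ne _ _ _ _ fun e => h (MulAction.injective x e), hrW x z z' hz,
      (hp.mul hmono (hκ.sub hmono isEquivariant_delta)).char_conj hmono]

theorem existsUnique_klsStep_fixed (hr : IsWeakRankFunction r)
    (hrW : ∀ (w : W) (z z' : B), z ≤ z' → r (w • z) (w • z') = r z z')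
    (hκ : κ.IsEquivariant) (hκU : κ.MemU) :
    ∃! g : IntervalFn W B, g.IsEquivariant ∧ klsStep r κ g = g :=
  existsUnique_fixedPoint hr ⟨delta, isEquivariant_delta⟩
    (fun _ hp => isEquivariant_klsStep hmono hrW hκ hp) fun p p' hp hp' z z' hz h => by
      unfold klsStep
      rw [mul_congr_of_lt hmono hp hp' (hκ.sub hmono isEquivariant_delta) hz
        (sub_delta_self hκU z') h]

/-- Since `g (κ - δ) = g^rev - g`, its low half is `-g`; uniqueness of `g` is then uniqueness of the
fixed point. -/
theorem IsLeftKLS.klsStep_eq (hκ : κ.IsEquivariant) {g : IntervalFn W B} (hg : IsLeftKLS r κ g) :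
    klsStep r κ g = g := by
  funext z z' hz
  by_cases h : z = z'
  · subst h
    rw [klsStep_self, hg.2.1]
  · rw [klsStep_of_ne _ _ _ _ h, mul_sub' hmono hg.1.1.1 hκ isEquivariant_delta,
      mul_delta hmono hg.1.1.1, ← hg.2.2, sub_apply, rev,
      halfTrunc_reflect_sub (hg.1.2 z z' (lt_of_le_of_ne hz h)), neg_neg]

/-- Induction on `r z z'`. The reversal of `Q = g (κ - δ)` is `g^rev (κ^rev - δ)`, which at `[z,
z']` involves `g^rev` only on shorter intervals. There `g^rev = g κ`, so `κ κ^rev = δ` yields `Q^rev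
= g - g κ = -Q`, and `reflect_halfTrunc_of_antisymm` applies. -/
theorem isLeftKLS_of_klsStep_eq (hr : IsWeakRankFunction r)
    (hrW : ∀ (w : W) (z z' : B), z ≤ z' → r (w • z) (w • z') = r z z')
    (hκ : κ.MemI r) (hκU : κ.MemU) (hκinv : κ.mul (κ.rev r) = delta)
    {g : IntervalFn W B} (hg : g.IsEquivariant) (hfix : klsStep r κ g = g) :
    IsLeftKLS r κ g := by
  have hgU : g.MemU := fun z => by rw [← hfix]; exact klsStep_self r κ g z
  have hhalf : ∀ z z' (h : z < z'), 2 * (g z z' h.le).natDegree < r z z' := fun z z' h => by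
    rw [← hfix, klsStep_of_ne _ _ _ _ h.ne, natDegree_neg]
    exact natDegree_halfTrunc_lt (hr.pos z z' h) _
  have hgI : g.MemI r := by
    refine ⟨hg, fun z z' hz => ?_⟩
    rcases hz.eq_or_lt with rfl | h
    · rw [hgU]
      exact degree_one_le.trans (by exact_mod_cast Nat.zero_le _)
    · have := hhalf z z' h
      exact degree_le_of_natDegree_le (by omega)
  refine ⟨⟨hgI, hhalf⟩, hgU, ?_⟩
  have hk := hκ.sub hmono (memI_delta (r := r))
  have hgκ := hgI.mul hmono hr hκ
  have hκr := hκ.rev hmono hrW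
  have hkrev : (κ - delta).rev r = κ.rev r - delta := by rw [rev_sub, rev_delta hr]
  have hQ : g.mul (κ - delta) = g.mul κ - g := by
    rw [mul_sub' hmono hg hκ.1 isEquivariant_delta, mul_delta hmono hg]
  have hQ' : (g.mul κ).mul (κ.rev r - delta) = g - g.mul κ := by
    rw [mul_sub' hmono hgκ.1 hκr.1 isEquivariant_delta, mul_delta hmono hgκ.1,
      mul_assoc' hmono hg hκ.1 hκr.1, hκinv, mul_delta hmono hg]
  have key : ∀ n z z' hz, r z z' = n → g.rev r z z' hz = g.mul κ z z' hz := fun n => by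
    induction n using Nat.strong_induction_on with
    | _ n ih =>
    intro z z' hz hn
    have hlt : ∀ u hu, u < z' → g.rev r z u hu = g.mul κ z u hu := fun u hu huz => by
      refine ih (r z u) ?_ z u hu rfl
      have h1 := hr.add z u z' hu huz.le
      have h2 := hr.pos u z' huz
      omega
    refine ext_char_apply hz fun w => ?_
    by_cases hzz : z = z'
    · subst hzz
      have hsub : (g.mul κ - g : IntervalFn W B) z z hz = 0 := by
        rw [← hQ, mul_congr_of_lt hmono hg isEquivariant_delta hk.1 hz (sub_delta_self hκU z)
          (fun u hu huz => absurd hu huz.not_ge), delta_mul hmono hk.1, sub_delta_self hκU]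
      have hs : g.mul κ z z hz = g z z hz := sub_eq_zero.mp hsub
      refine char_congr (fun _ => ?_) w
      rw [hs, rev, hgU, hr.self, reflect_one, pow_zero]
    · have hanti : reflect (r z z') ((g.mul (κ - delta)).char w z z') =
          -(g.mul (κ - delta)).char w z z' := by
        rw [← char_rev, rev_mul hmono hr hrW hgI hk, hkrev,
          char_congr (fun h => mul_congr_of_lt hmono (hgI.rev hmono hrW).1 hgκ.1
            (hκr.1.sub hmono isEquivariant_delta) h
            (by rw [← hkrev, rev, sub_delta_self hκU, reflect_zero]) hlt), hQ', hQ, char_sub,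
          char_sub, neg_sub]
      have hd := ((memI_iff_char.mp (hgI.mul hmono hr hk)).2 w z z')
      have := reflect_halfTrunc_of_antisymm hd hanti
      rw [← char_klsStep_of_ne r κ g w hzz, hfix, hQ, char_sub, sub_add_cancel] at this
      rw [char_rev, this]
  funext z z' hz
  exact key _ z z' hz rfl

/-- Existence and uniqueness of the left equivariant Kazhdan-Lusztig-Stanley function. -/
theorem existsUnique_isLeftKLS (hr : IsWeakRankFunction r)
    (hrW : ∀ (w : W) (z z' : B), z ≤ z' → r (w • z) (w • z') = r z z')
    (hκ : κ.MemI r) (hκU : κ.MemU) (hκinv : κ.mul (κ.rev r) = delta) :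
    ∃! g : IntervalFn W B, IsLeftKLS r κ g := by
  obtain ⟨g, ⟨hg, hfix⟩, huniq⟩ := existsUnique_klsStep_fixed hmono hr hrW hκ.1 hκU
  exact ⟨g, isLeftKLS_of_klsStep_eq hmono hr hrW hκ hκU hκinv hg hfix,
    fun g' hg' => huniq g' ⟨hg'.1.1.1, hg'.klsStep_eq hmono hκ.1⟩⟩

/-- The intervals `[u, u ∨ q]` with `u` not above `q` are nontrivial, so every surviving `κ` factor
vanishes at `1` on characters. As `X - 1` is monic, a root at `1` gives divisibility over the
representation ring itself. -/
theorem X_sub_one_dvd_mul_restrict {q : B} (hq : IsJoinAdmissible q)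
    (hqW : ∀ w : W, w • q = q) (hW : IsEulerianAction W B) (hκ : κ.MemI r)
    (hκm : κ.IsMultiplicative) (hκa : κ.IsRankAlternating r)
    {g : IntervalFn W B} (hg : g.IsEquivariant) (z z' : B) (hz : z ≤ z') :
    (X - 1 : (RepRing (stab₂ W z z'))[X]) ∣ g.mul (κ.restrict (joinIntervals hq)) z z' hz := by
  have := Fintype.ofFinite B
  rw [← C_1, dvd_iff_isRoot, IsRoot.def]
  refine RepRing.ext_ev fun v => ?_
  rw [map_zero, ← eval_map_apply, map_one, ← char_of _ hz v.2.1 v.2.2,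
    char_mul hmono hg (hκ.1.restrict hmono (joinIntervals_smul hmono hq hqW)), eval_finsetSum]
  refine Finset.sum_eq_zero fun u _ => ?_
  rw [eval_mul, char_restrict]
  split_ifs with hu
  · by_cases hfix : (v : W) • u = u
    · obtain ⟨-, ρ, hρ, -⟩ := hW v
      have hlt : u < z' := lt_of_le_of_ne (hu.2 ▸ le_sigma hq u) fun e =>
        hu.1 (by rw [e, hu.2]; exact le_of_sigma_eq hq u)
      rw [show eval 1 (κ.char v u z') = 0 from eval_one_toMatrix hκ hκm hκa hρ
        (z := ⟨u, hfix⟩) (z' := ⟨z', v.2.2⟩) hlt, mul_zero]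
    · rw [char_eq_zero κ fun h => hfix h.2.1, eval_zero, mul_zero]
  · rw [eval_zero, mul_zero]

/-- Existence and uniqueness of the equivariant `h`-polynomials. -/
theorem existsUnique_isHPolynomial {q : B} (hq : IsJoinAdmissible q)
    (hqW : ∀ w : W, w • q = q) (hW : IsEulerianAction W B) (hr : IsWeakRankFunction r)
    (hκ : κ.MemI r) (hκm : κ.IsMultiplicative) (hκa : κ.IsRankAlternating r)
    {g : IntervalFn W B} (hg : g.MemI r) : ∃! h : IntervalFn W B, IsHPolynomial r hq κ g h := by
  obtain ⟨h, hh⟩ : ∃ h : IntervalFn W B, ∀ z z' hz,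
      g.mul (κ.restrict (joinIntervals hq)) z z' hz = (X - 1) * h z z' hz := by
    choose h hh using X_sub_one_dvd_mul_restrict hmono hq hqW hW hκ hκm hκa hg.1
    exact ⟨h, hh⟩
  have ht : h.tSubOneMul = g.mul (κ.restrict (joinIntervals hq)) := by
    funext z z' hz
    exact (hh z z' hz).symm
  have hI : h.tSubOneMul.MemI r := by
    rw [ht]
    exact hg.mul hmono hr (hκ.restrict hmono (joinIntervals_smul hmono hq hqW))
  refine ⟨h, ⟨⟨(isEquivariant_tSubOneMul_iff hmono).mp hI.1, fun z z' hz => ?_⟩, ht⟩,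
    fun h' hh' => ?_⟩
  · have := natDegree_le_of_X_sub_one_mul (hI.2 z z' hz)
    exact degree_le_of_natDegree_le (by omega)
  · have e : h'.tSubOneMul = h.tSubOneMul := hh'.2.trans ht.symm
    funext z z' hz
    have hm : (X - 1 : (RepRing (stab₂ W z z'))[X]).Monic := by rw [← C_1]; exact monic_X_sub_C 1
    exact hm.isRegular.left (congrFun (congrFun (congrFun e z) z') hz)

theorem mul_neg' {p p' : IntervalFn W B} (hp : p.IsEquivariant) (hp' : p'.IsEquivariant) :
    p.mul (-p') = -(p.mul p') := by
  have := Fintype.ofFinite B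
  refine ext_char fun w z z' => ?_
  rw [char_neg, char_mul hmono hp (hp'.neg hmono), char_mul hmono hp hp', ← Finset.sum_neg_distrib]
  simp only [char_neg, mul_neg]

theorem neg_mul' {p p' : IntervalFn W B} (hp : p.IsEquivariant) (hp' : p'.IsEquivariant) :
    (-p).mul p' = -(p.mul p') := by
  have := Fintype.ofFinite B
  refine ext_char fun w z z' => ?_
  rw [char_neg, char_mul hmono (hp.neg hmono) hp', char_mul hmono hp hp', ← Finset.sum_neg_distrib]
  simp only [char_neg, neg_mul]

/-- If `g` is the left Kazhdan-Lusztig-Stanley function of `κ` and `κ a^rev = - a κ`, then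
`g a g⁻¹` is antisymmetric. -/
theorem rev_conj_eq_neg (hr : IsWeakRankFunction r)
    (hrW : ∀ (w : W) (z z' : B), z ≤ z' → r (w • z) (w • z') = r z z')
    (hκ : κ.MemI r) {g g' a : IntervalFn W B} (hg : IsLeftKLS r κ g) (hg' : IsInverse g g')
    (hg'I : g'.MemI r) (ha : a.MemI r) (haκ : κ.mul (a.rev r) = -(a.mul κ)) :
    ((g.mul a).mul g').rev r = -((g.mul a).mul g') := by
  have hgI := hg.1.1
  have hga := hgI.mul hmono hr ha
  have hL := hga.mul hmono hr hg'I
  have hgr := hgI.rev hmono hrW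
  have hg'r := hg'I.rev hmono hrW
  have har := ha.rev hmono hrW
  have hLr := hL.rev hmono hrW
  have hinv : (g.rev r).mul (g'.rev r) = delta := by
    rw [← rev_mul hmono hr hrW hgI hg'I, hg'.2.1, rev_delta hr]
  -- Both sides are compared after right multiplication by `g^rev`, which is invertible with inverse
  -- `(g⁻¹)^rev`.
  have e1 : (((g.mul a).mul g').rev r).mul (g.rev r) = -((g.mul a).mul κ) := by
    rw [← rev_mul hmono hr hrW hL hgI, mul_assoc' hmono hga.1 hg'I.1 hgI.1, hg'.2.2,
      mul_delta hmono hga.1, rev_mul hmono hr hrW hgI ha, hg.2.2,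
      mul_assoc' hmono hgI.1 hκ.1 har.1, haκ, mul_neg' hmono hgI.1 (ha.1.mul hmono hκ.1),
      mul_assoc' hmono hgI.1 ha.1 hκ.1]
  have e2 : (-((g.mul a).mul g')).mul (g.rev r) = -((g.mul a).mul κ) := by
    rw [neg_mul' hmono hL.1 hgr.1, mul_assoc' hmono hga.1 hg'I.1 hgr.1, hg.2.2,
      ← mul_assoc' hmono hg'I.1 hgI.1 hκ.1, hg'.2.2, delta_mul hmono hκ.1]
  rw [← mul_delta hmono hLr.1, ← hinv, ← mul_assoc' hmono hLr.1 hgr.1 hg'r.1, e1, ← e2,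
    mul_assoc' hmono (hL.1.neg hmono) hgr.1 hg'r.1, hinv, mul_delta hmono (hL.1.neg hmono)]

end IntervalFn

end KazhdanLusztigStanley

end

end EquivariantKLS

/-! ### Symmetry of the local `h`-polynomials. -/

open EquivariantKLS EquivariantKLS.IntervalFn Polynomial in
theorem corollary4p13 {W : Type*} [Group W] [Finite W] {Γ : Type*} [PartialOrder Γ] [Finite Γ]
    [MulAction W Γ] (hmono : ∀ (w : W) (z z' : Γ), z ≤ z' → w • z ≤ w • z')
    (hΓ : IsLowerEulerian Γ)
    (q : Γ) (hq : IsJoinAdmissible q) (hq0 : ¬ IsMin q) (hqW : ∀ w : W, w • q = q)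
    (hW : IsEulerianAction W Γ)
    (r : Γ → Γ → ℕ) (hr : IsWeakRankFunction r)
    (hrW : ∀ (w : W) (z z' : Γ), z ≤ z' → r (w • z) (w • z') = r z z')
    (κ : IntervalFn W Γ) (hκ : κ.MemI r) (hκU : κ.MemU)
    (hκm : κ.IsMultiplicative) (hκa : κ.IsRankAlternating r) :
    (∃! g : IntervalFn W Γ, IsLeftKLS r κ g) ∧
    ∀ g : IntervalFn W Γ, IsLeftKLS r κ g →
      (∃! g' : IntervalFn W Γ, IsInverse g g') ∧
      (∃! h : IntervalFn W Γ, IsHPolynomial r hq κ g h) ∧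
      ∀ g' h ℓ : IntervalFn W Γ, IsInverse g g' → IsHPolynomial r hq κ g h → ℓ = h.mul g' →
        ℓ.MemI r ∧
        (∀ x ∈ lowerPart q, ∀ y ∈ upperPart q, ∀ hxy : sigma hq x ≤ y,
          toLaurent (ℓ x y ((le_sigma hq x).trans hxy)) =
            LaurentPolynomial.T ((r x y : ℤ) - 1) *
              LaurentPolynomial.invert (toLaurent (ℓ x y ((le_sigma hq x).trans hxy)))) ∧
        ℓ.tSubOneMul.MemI r ∧
        (∀ (z z' : Γ) (hz : z ≤ z'), ℓ.tSubOneMul z z' hz = -(ℓ.tSubOneMul.rev r z z' hz)) := by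
  have hκinv := mul_rev_eq_delta hmono hr hrW hW hκ hκU hκm hκa
  refine ⟨existsUnique_isLeftKLS hmono hr hrW hκ hκU hκinv, fun g hg => ?_⟩
  have hgI := hg.1.1
  obtain ⟨g₀, hg₀, hg₀I⟩ := exists_isInverse hmono hr hgI hg.2.1
  refine ⟨⟨g₀, hg₀, fun g' hg' => hg'.eq hmono hgI.1 hg₀⟩,
    existsUnique_isHPolynomial hmono hq hqW hW hr hκ hκm hκa hgI, ?_⟩
  rintro g' h ℓ hg' hh rfl
  obtain rfl := hg'.eq hmono hgI.1 hg₀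
  have hκX := hκ.restrict hmono (joinIntervals_smul hmono hq hqW)
  have ht : (h.mul g').tSubOneMul = (g.mul (κ.restrict (joinIntervals hq))).mul g' := by
    rw [tSubOneMul_mul hmono hh.1.1 hg'.1, hh.2]
  have hI : (h.mul g').tSubOneMul.MemI r := by
    rw [ht]
    exact (hgI.mul hmono hr hκX).mul hmono hr hg₀I
  have hanti : ∀ (z z' : Γ) (hz : z ≤ z'),
      (h.mul g').tSubOneMul z z' hz = -((h.mul g').tSubOneMul.rev r z z' hz) := fun z z' hz => by
    have e := rev_conj_eq_neg hmono hr hrW hκ hg hg' hg₀I hκX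
      (mul_rev_restrict hmono hq hqW hrW hW hκ hκm hκa)
    rw [ht, e, IntervalFn.neg_apply, neg_neg]
  refine ⟨hh.1.mul hmono hr hg₀I, fun x hx y hy hxy => ?_, hI, hanti⟩
  have hle := (le_sigma hq x).trans hxy
  -- `x` lies outside `Y` and `y` inside, so `x < y`; hence `r x y - 1` in `ℕ` is the true exponent
  -- of the Laurent identity.
  have hpos : 0 < r x y := hr.pos x y (lt_of_le_of_ne hle fun e => hx (e ▸ hy))
  have hdeg := natDegree_le_of_X_sub_one_mul (hI.2 x y hle)
  have e := eq_reflect_of_X_sub_one_mul hpos hdeg (hanti x y hle)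
  have e' := congrArg toLaurent e
  rwa [toLaurent_reflect hdeg, Nat.cast_sub hpos, Nat.cast_one] at e'
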